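/- Let $M$ be an $n$-dimensional $C^\infty$-manifold (Hausdorff, second countable, without boundary), and let $D=\{u_1,\dots,u_k\}$ be a finite collection of smooth forward complete vector fields on $M$, indexed by $S=\{1,\dots,k\}$; forward complete means that for every $\eta\in M$ the equation $\dot x=u_i(x)$, $x(0)=\eta$, has a solution $t\mapsto\Phi_i(t,\eta)$ for all $t\ge 0$. For each $i\in S$ let $\lambda_i>0$, and let $(q_{ij})_{j\in S}$ be a probability distribution on $S$ with $q_{ii}=0$ and $q_{ij}>0$ for all $j\ne i$. For $(\xi,i)\in M\times S$, let $(X_t,A_t)_{t\ge0}$ be the following process on $M\times S$. The successive regimes form a Markov chain on $S$ started at $i$ with transition probabilities $q_{ij}$; given this chain, the times spent in the successive regimes are independent, a stay in regime $j$ being exponentially distributed with parameter $\lambda_j$; $A_t$ is the regime at time $t$, and $X_t$ is the continuous trajectory with $X_0=\xi$ that follows $u_j$ during each stay in the regime $j$. Let $\mathsf P^t_{\xi,i}$ be the distribution of $(X_t,A_t)$, a probability measure on $M\times S$. Let $\mathcal I(D)$ be the smallest Lie algebra of smooth vector fields on $M$ (real subspace closed under the Lie bracket) that contains $D$, let $\mathcal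 I'(D)$ be the smallest Lie algebra containing all brackets $[v,w]$ with $v,w\in\mathcal I(D)$, and let $$\mathcal I_0(D)=\Bigl\{v+\sum_{i=1}^k c_iu_i:\ v\in\mathcal I'(D),\ c_1,\dots,c_k\in\mathbb R,\ \sum_{i=1}^k c_i=0\Bigr\}.$$ A point $\xi\in M$ satisfies Condition A if the subspace $\{w(\xi): w\in\mathcal I_0(D)\}$ of the tangent space $T_\xi M$ has dimension $n$. Let $\lambda^M$ be the volume measure of a smooth Riemannian metric on $M$, and let the Lebesgue measure on $M\times S$ be the product of $\lambda^M$ and the counting measure on $S$. **Theorem.** If Condition A is satisfied at a point $\xi\in M$, then for every $i\in S$ and every $t>0$, the transition probability $\mathsf P^t_{\xi,i}$ has a nonzero absolutely continuous component with respect to the Lebesgue measure on $M\times S$: in its Lebesgue decomposition into an absolutely continuous and a singular part, the absolutely continuous part is not zero. -/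

import Mathlib

open scoped Manifold ContDiff
open MeasureTheory ProbabilityTheory

section VectorFields

variable {n k : ℕ} {M : Type*} [TopologicalSpace M] [ChartedSpace (EuclideanSpace ℝ (Fin n)) M]

/-- `F` is closed under the Lie bracket of vector fields. -/
def Involutive (F : Submodule ℝ (∀ x : M, TangentSpace (𝓡 n) x)) : Prop :=
  ∀ v ∈ F, ∀ w ∈ F, VectorField.mlieBracket (𝓡 n) v w ∈ F

/-- The smallest Lie algebra of vector fields containing the set `D`. If all members of `D` are
smooth, then so are all members of `lieClosure D`, because the smooth vector fields form an
involutive subspace. -/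
noncomputable def lieClosure (D : Set (∀ x : M, TangentSpace (𝓡 n) x)) :
    Submodule ℝ (∀ x : M, TangentSpace (𝓡 n) x) :=
  sInf {F | D ⊆ F ∧ Involutive F}

/-- The derived algebra of the Lie algebra generated by `D`: the smallest Lie algebra that contains
the brackets of the members of `lieClosure D`. -/
noncomputable def derivedAlgebra (D : Set (∀ x : M, TangentSpace (𝓡 n) x)) :
    Submodule ℝ (∀ x : M, TangentSpace (𝓡 n) x) :=
  lieClosure {b | ∃ v ∈ lieClosure D, ∃ w ∈ lieClosure D, b = VectorField.mlieBracket (𝓡 n) v w}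

/-- The zero-time ideal of the family `u`: all vector fields `v + ∑ i, c i • u i` with `v` in the
derived algebra and `∑ i, c i = 0`. -/
noncomputable def zeroTimeIdeal (u : Fin k → ∀ x : M, TangentSpace (𝓡 n) x) :
    Submodule ℝ (∀ x : M, TangentSpace (𝓡 n) x) where
  carrier := {w | ∃ v ∈ derivedAlgebra (Set.range u), ∃ c : Fin k → ℝ,
    ∑ i, c i = 0 ∧ w = v + ∑ i, c i • u i}
  zero_mem' := ⟨0, zero_mem _, 0, by simp, by simp⟩
  add_mem' := by
    rintro _ _ ⟨v, hv, c, hc, rfl⟩ ⟨v', hv', c', hc', rfl⟩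
    refine ⟨v + v', add_mem hv hv', c + c', ?_, ?_⟩
    · simp [Finset.sum_add_distrib, hc, hc']
    · simp only [Pi.add_apply, add_smul, Finset.sum_add_distrib]
      abel
  smul_mem' := by
    rintro a _ ⟨v, hv, c, hc, rfl⟩
    refine ⟨a • v, Submodule.smul_mem _ a hv, a • c, ?_, ?_⟩
    · simp [← Finset.mul_sum, hc]
    · simp only [Pi.smul_apply, smul_add, Finset.smul_sum, smul_assoc]

/-- The subspace `{w ξ | w ∈ zeroTimeIdeal u}` of the tangent space at `ξ`. -/
noncomputable def zeroTimeIdealAt (u : Fin k → ∀ x : M, TangentSpace (𝓡 n) x) (ξ : M) :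
    Submodule ℝ (TangentSpace (𝓡 n) ξ) :=
  (zeroTimeIdeal u).map (LinearMap.proj ξ)

/-- Condition A at `ξ`: the zero-time ideal has full dimension `n` at `ξ`. -/
def ConditionA (u : Fin k → ∀ x : M, TangentSpace (𝓡 n) x) (ξ : M) : Prop :=
  Module.finrank ℝ (zeroTimeIdealAt u ξ) = n

/-- Every initial value `η` has a solution of `γ' = v(γ)`, `γ 0 = η` for all times `t ≥ 0`
(with the one-sided derivative at `0`). -/
def ForwardComplete (v : ∀ x : M, TangentSpace (𝓡 n) x) : Prop :=
  ∀ η : M, ∃ γ : ℝ → M, γ 0 = η ∧ IsMIntegralCurveOn γ v (Set.Ici 0)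

open Classical in
/-- The forward flow: `forwardFlow v t η` is the value at time `t ≥ 0` of the solution of
`γ' = v(γ)`, `γ 0 = η`. On a Hausdorff manifold, for a forward complete smooth `v`, this value is
unique. It is only used for `t ≥ 0`. -/
noncomputable def forwardFlow (v : ∀ x : M, TangentSpace (𝓡 n) x) (t : ℝ) (η : M) : M :=
  if h : ∃ γ : ℝ → M, γ 0 = η ∧ IsMIntegralCurveOn γ v (Set.Ici 0) then h.choose t else η

end VectorFields

section RiemannianMeasure

variable {n : ℕ} {M : Type*} [TopologicalSpace M] [ChartedSpace (EuclideanSpace ℝ (Fin n)) M]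
  [IsManifold (𝓡 n) ∞ M]

/-- Smooth Riemannian metrics on `M`. -/
abbrev SmoothMetric (n : ℕ) (M : Type*) [TopologicalSpace M]
    [ChartedSpace (EuclideanSpace ℝ (Fin n)) M] [IsManifold (𝓡 n) ∞ M] :=
  Bundle.ContMDiffRiemannianMetric (𝓡 n) ∞ (EuclideanSpace ℝ (Fin n))
    (fun x : M => TangentSpace (𝓡 n) x)

/-- The `j`-th coordinate vector field of the chart `e`, at the point with coordinates `y`. -/
noncomputable def coordVector (e : OpenPartialHomeomorph M (EuclideanSpace ℝ (Fin n)))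
    (y : EuclideanSpace ℝ (Fin n)) (j : Fin n) : TangentSpace (𝓡 n) (e.symm y) :=
  mfderiv (𝓡 n) (𝓡 n) e.symm y (EuclideanSpace.single j (1 : ℝ) : EuclideanSpace ℝ (Fin n))

/-- The Riemannian volume density `√(det (g_{jl}))` in the chart `e`, at the point with
coordinates `y`. -/
noncomputable def volumeDensity (g : SmoothMetric n M)
    (e : OpenPartialHomeomorph M (EuclideanSpace ℝ (Fin n))) (y : EuclideanSpace ℝ (Fin n)) : ℝ :=
  Real.sqrt (Matrix.det (Matrix.of fun j l : Fin n =>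
    g.inner (e.symm y) (coordVector e y j) (coordVector e y l)))

variable [T2Space M] [SecondCountableTopology M]

/-- There is a smooth partition of unity subordinate to the domains of the charts of `M`. -/
theorem exists_chartPartition (n : ℕ) (M : Type*) [TopologicalSpace M]
    [ChartedSpace (EuclideanSpace ℝ (Fin n)) M] [IsManifold (𝓡 n) ∞ M] [T2Space M]
    [SecondCountableTopology M] :
    ∃ ρ : SmoothPartitionOfUnity M (𝓡 n) M Set.univ,
      ρ.IsSubordinate (fun x => (chartAt (EuclideanSpace ℝ (Fin n)) x).source) := by
  have : LocallyCompactSpace M :=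
    ChartedSpace.locallyCompactSpace (EuclideanSpace ℝ (Fin n)) M
  exact SmoothPartitionOfUnity.exists_isSubordinate_chartAt_source (𝓡 n) M

/-- A smooth partition of unity subordinate to the domains of the charts of `M`. -/
noncomputable def chartPartition (n : ℕ) (M : Type*) [TopologicalSpace M]
    [ChartedSpace (EuclideanSpace ℝ (Fin n)) M] [IsManifold (𝓡 n) ∞ M] [T2Space M]
    [SecondCountableTopology M] : SmoothPartitionOfUnity M (𝓡 n) M Set.univ :=
  (exists_chartPartition n M).choose

/-- The Riemannian volume measure of `g` (the Lebesgue measure on `M`): the measures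
`ρ √(det (g_{jl})) dy` on the chart domains, added up over a subordinate partition of unity. -/
noncomputable def lebesgueMeasure [MeasurableSpace M] (g : SmoothMetric n M) : Measure M :=
  Measure.sum fun c : M =>
    let e := chartAt (EuclideanSpace ℝ (Fin n)) c
    Measure.map e.symm
      ((volume.restrict e.target).withDensity fun y =>
        ENNReal.ofReal (chartPartition n M c (e.symm y) * volumeDensity g e y))

end RiemannianMeasure

/-- A dynamical system with random switching on `M`: finitely many smooth forward complete vector
fields, the parameters of the exponential holding times, and for each regime `i` the distribution
`jump i` of the next regime, which charges every regime but `i`. -/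
structure SwitchingSystem (n k : ℕ) (M : Type*) [TopologicalSpace M]
    [ChartedSpace (EuclideanSpace ℝ (Fin n)) M] [IsManifold (𝓡 n) ∞ M] where
  field : Fin k → ∀ x : M, TangentSpace (𝓡 n) x
  smooth : ∀ i, ContMDiff (𝓡 n) (𝓡 n).tangent ∞
    fun x => (⟨x, field i x⟩ : TangentBundle (𝓡 n) M)
  forwardComplete : ∀ i, ForwardComplete (field i)
  rate : Fin k → ℝ
  rate_pos : ∀ i, 0 < rate i
  jump : Fin k → PMF (Fin k)
  jump_self : ∀ i, jump i i = 0
  jump_pos : ∀ i j, i ≠ j → 0 < jump i j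

namespace SwitchingSystem

variable {n k : ℕ} {M : Type*} [TopologicalSpace M]
  [ChartedSpace (EuclideanSpace ℝ (Fin n)) M] [IsManifold (𝓡 n) ∞ M] (Z : SwitchingSystem n k M)

/-- The exponential distribution of the time spent in the regime `i` before the next switch. -/
noncomputable def holdingKernel : Kernel (Fin k) ℝ :=
  Kernel.ofFunOfCountable fun i => expMeasure (Z.rate i)

instance : IsMarkovKernel Z.holdingKernel :=
  ⟨fun i => isProbabilityMeasure_expMeasure (Z.rate_pos i)⟩

/-- Given the current regime, the law of the next regime together with its holding time. -/
noncomputable def stepKernel : Kernel (Fin k) (Fin k × ℝ) :=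
  Kernel.ofFunOfCountable fun i => (Z.jump i).toMeasure ⊗ₘ Z.holdingKernel

instance : IsMarkovKernel Z.stepKernel :=
  ⟨fun i => inferInstanceAs (IsProbabilityMeasure ((Z.jump i).toMeasure ⊗ₘ Z.holdingKernel))⟩

/-- Given the regimes and holding times up to the index `m`, the law of those with index `m + 1`:
it depends on the `m`-th regime only. -/
noncomputable def pathKernel (m : ℕ) :
    Kernel (∀ _ : Finset.Iic m, Fin k × ℝ) (Fin k × ℝ) :=
  Z.stepKernel.comap (fun h => (h ⟨m, Finset.mem_Iic.2 le_rfl⟩).1) (by fun_prop)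

instance (m : ℕ) : IsMarkovKernel (Z.pathKernel m) := by
  unfold pathKernel
  infer_instance

/-- The law of the sequence of successive regimes and holding times with initial regime `i`. -/
noncomputable def pathLaw (i : Fin k) : Measure (ℕ → Fin k × ℝ) :=
  Kernel.trajMeasure (X := fun _ => Fin k × ℝ) (Measure.dirac i ⊗ₘ Z.holdingKernel) Z.pathKernel

/-- The time of the `m`-th switch (`0` for `m = 0`). -/
noncomputable def switchTime (path : ℕ → Fin k × ℝ) (m : ℕ) : ℝ :=
  ∑ l ∈ Finset.range m, (path l).2

/-- The number of switches up to time `t`: the `m` with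
`switchTime path m ≤ t < switchTime path (m + 1)`, which exists almost surely. -/
noncomputable def switchCount (path : ℕ → Fin k × ℝ) (t : ℝ) : ℕ :=
  sInf {m | t < switchTime path (m + 1)}

/-- The position at the time of the `m`-th switch, starting from `ξ`. -/
noncomputable def switchPosition (ξ : M) (path : ℕ → Fin k × ℝ) : ℕ → M
  | 0 => ξ
  | m + 1 => forwardFlow (Z.field (path m).1) (path m).2 (switchPosition ξ path m)

/-- The process `A`: the regime at time `t`. -/
noncomputable def regime (path : ℕ → Fin k × ℝ) (t : ℝ) : Fin k :=
  (path (switchCount path t)).1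

/-- The process `X`: the position at time `t`, starting from `ξ`. -/
noncomputable def position (ξ : M) (path : ℕ → Fin k × ℝ) (t : ℝ) : M :=
  forwardFlow (Z.field (regime path t)) (t - switchTime path (switchCount path t))
    (Z.switchPosition ξ path (switchCount path t))

/-- The transition probability `P^t_{ξ,i}`: the law of `(X_t, A_t)` started at `(ξ, i)`. -/
noncomputable def transition [MeasurableSpace M] (t : ℝ) (ξ : M) (i : Fin k) :
    Measure (M × Fin k) :=
  (Z.pathLaw i).map fun path => (Z.position ξ path t, regime path t)

end SwitchingSystem

/-- `μ` has a nonzero absolutely continuous component with respect to `ν`: in its Lebesgue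
decomposition `μ = μac + μs`, the part `μac` is not zero. -/
def HasNonzeroACComponent {α : Type*} [MeasurableSpace α] (μ ν : Measure α) : Prop :=
  ∃ μac μs : Measure α, μ = μac + μs ∧ μac ≪ ν ∧ μs ⟂ₘ ν ∧ μac ≠ 0

/-! Fix a sequence of regimes. The position and the elapsed time after its stays form a map from the
stay lengths `s` to space-time `E × ℝ`. Suppose that its derivative is onto at some `s` with total
time less than `t`. Near `s`, preimages of null sets are then null sets. Append a stay longer than
`t` in a regime `j`: at time `t` the process is in regime `j`, at the point to which the flow of
`u_j` carries `x` in time `t - T`, where `(x, T)` is the configuration reached before. For fixed `T`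
this flow pulls null sets back to null sets, so by Fubini the pairs `(x, T)` that lead into a given
null set form a null set, and so do the corresponding `s`. All admissible regime sequences, with
holding times in any set of positive volume in the positive orthant, have positive probability.
Hence no null set carries the law at time `t`, and the absolutely continuous part is nonzero
(`hasNonzeroACComponent_of_forall_null`).

Surjectivity comes from Condition A by a maximality argument (`exists_maximal_configurations`).
Among the configurations reached in time less than `δ`, take those whose space `V` of directions has
the largest dimension. Following one more flow transports `V` injectively and adds the direction
`(u_j, 1)`; by maximality the new space is just the transported one. So `(u_j, 1) ∈ V`, and if `(v,
r)` lies in `V` at all maximal configurations, its pullback along the flow of `u_j` stays in `V`.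
Differentiating the pullback gives `([u_j, v], 0) ∈ V`. The fields `v` with `(v, 0)` in all these
spaces therefore include the derived algebra and all combinations `∑ c_i u_i` with `∑ c_i = 0`, that
is, the zero-time ideal. Near `ξ` this ideal spans all directions of space; together with `(u_j, 1)`
they span space-time (`exists_attains_top`).

The argument uses flows of class `C²` in a chart, obtained for compactly supported cutoffs of the
fields from the implicit function theorem for the Picard operator on `C([0, 1], E)`. -/

/-! ### Smoothness of superposition operators -/

section Nemytskii

open Set Filter Topology Metric

universe u

variable {K : Type*} [TopologicalSpace K]

/-- The superposition operator `γ ↦ f ∘ γ` on spaces of continuous functions. -/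
def superposition {E F : Type*} [TopologicalSpace E] [TopologicalSpace F] (f : C(E, F))
    (γ : C(K, E)) : C(K, F) := f.comp γ

@[simp] lemma superposition_apply {E F : Type*} [TopologicalSpace E] [TopologicalSpace F]
    (f : C(E, F)) (γ : C(K, E)) (t : K) : superposition f γ t = f (γ t) := rfl

variable [CompactSpace K]

/-- Pointwise application of a continuous family of operators, as a bounded bilinear map. -/
noncomputable def pointwiseApply (K : Type*) [TopologicalSpace K] [CompactSpace K]
    (E F : Type*) [NormedAddCommGroup E] [NormedSpace ℝ E] [NormedAddCommGroup F]
    [NormedSpace ℝ F] : C(K, E →L[ℝ] F) →L[ℝ] C(K, E) →L[ℝ] C(K, F) :=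
  LinearMap.mkContinuous₂
    (LinearMap.mk₂ ℝ (fun (A : C(K, E →L[ℝ] F)) (h : C(K, E)) =>
        (⟨fun t => A t (h t), by fun_prop⟩ : C(K, F)))
      (fun A B h => by ext; simp) (fun c A h => by ext; simp)
      (fun A g h => by ext; simp) (fun c A h => by ext; simp)) 1 (fun A h => by
        rw [ContinuousMap.norm_le _ (by positivity)]
        intro t
        calc ‖A t (h t)‖ ≤ ‖A t‖ * ‖h t‖ := (A t).le_opNorm _
          _ ≤ 1 * ‖A‖ * ‖h‖ := by
            rw [one_mul]
            gcongr
            · exact A.norm_coe_le_norm t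
            · exact h.norm_coe_le_norm t)

@[simp] lemma pointwiseApply_apply {E F : Type*} [NormedAddCommGroup E] [NormedSpace ℝ E]
    [NormedAddCommGroup F] [NormedSpace ℝ F] (A : C(K, E →L[ℝ] F)) (h : C(K, E)) (t : K) :
    pointwiseApply K E F A h t = A t (h t) := rfl

/-- The range of `γ` is compact, so `f'` is uniformly continuous along it, and the mean value
inequality bounds the remainder uniformly in the parameter. -/
lemma hasFDerivAt_superposition {E F : Type*} [NormedAddCommGroup E] [NormedSpace ℝ E]
    [NormedAddCommGroup F] [NormedSpace ℝ F] (f : C(E, F)) (f' : C(E, E →L[ℝ] F))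
    (hf : ∀ x, HasFDerivAt f (f' x) x) (γ : C(K, E)) :
    HasFDerivAt (superposition (K := K) f) (pointwiseApply K E F (superposition f' γ)) γ := by
  rw [hasFDerivAt_iff_isLittleO_nhds_zero, Asymptotics.isLittleO_iff]
  intro c hc
  have hcomp : IsCompact (range γ) := isCompact_range γ.continuous
  have hu := hcomp.uniformContinuousAt_of_continuousAt f'
    (fun a _ => f'.continuous.continuousAt) (dist_mem_uniformity hc)
  obtain ⟨δ, hδ, hu⟩ := mem_uniformity_dist.1 hu
  filter_upwards [ball_mem_nhds (0 : C(K, E)) hδ] with h hh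
  rw [mem_ball_zero_iff] at hh
  rw [ContinuousMap.norm_le _ (by positivity)]
  intro t
  have hbound : ∀ z ∈ segment ℝ (γ t) (γ t + h t), ‖f' z - f' (γ t)‖ ≤ c := by
    intro z hz
    have h1 : ‖z - γ t‖ ≤ ‖h t‖ := by
      obtain ⟨θ, hθ, rfl⟩ := (segment_eq_image' ℝ (γ t) (γ t + h t)) ▸ hz
      simp only [add_sub_cancel_left, norm_smul, Real.norm_eq_abs, abs_of_nonneg hθ.1]
      exact mul_le_of_le_one_left (norm_nonneg _) hθ.2
    have h2 := hu (a := γ t) (b := z) (by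
      rw [dist_comm, dist_eq_norm]
      exact (h1.trans (h.norm_coe_le_norm t)).trans_lt hh) (mem_range_self t)
    rw [← dist_eq_norm, dist_comm]
    exact le_of_lt h2
  have := (convex_segment (γ t) (γ t + h t)).norm_image_sub_le_of_norm_hasFDerivWithin_le'
    (f := f) (φ := f' (γ t)) (fun z hz => (hf z).hasFDerivWithinAt) hbound
    (left_mem_segment ℝ _ _) (right_mem_segment ℝ _ _)
  simp only [add_sub_cancel_left] at this
  refine LE.le.trans (by simpa using this) (?_ : c * ‖h t‖ ≤ c * ‖h‖)
  gcongr
  exact h.norm_coe_le_norm t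

/-- The derivative is a bounded linear map applied to the superposition operator of `f'`, which has
one derivative less. The induction replaces `F` by `E →L[ℝ] F`, whence the common universe. -/
lemma contDiff_superposition (n : ℕ) {E F : Type u} [NormedAddCommGroup E] [NormedSpace ℝ E]
    [NormedAddCommGroup F] [NormedSpace ℝ F] (f : C(E, F)) (hf : ContDiff ℝ n f) :
    ContDiff ℝ n (superposition (K := K) f) := by
  induction n generalizing F with
  | zero =>
    simp only [Nat.cast_zero, contDiff_zero]
    exact ContinuousMap.continuous_postcomp f
  | succ n ih =>
    have h1 : ContDiff ℝ 1 f := hf.of_le (by norm_cast; omega)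
    have hd : ∀ x, HasFDerivAt f (fderiv ℝ f x) x :=
      fun x => (h1.differentiable (by simp) x).hasFDerivAt
    have hf' : ContDiff ℝ n (fderiv ℝ f) := hf.fderiv_right (by norm_cast)
    let f' : C(E, E →L[ℝ] F) := ⟨fderiv ℝ f, hf'.continuous⟩
    rw [show ((n + 1 : ℕ) : WithTop ℕ∞) = n + 1 by norm_cast, contDiff_succ_iff_hasFDerivAt]
    have hB : ContDiff ℝ n (pointwiseApply K E F) := ContinuousLinearMap.contDiff _
    exact ⟨fun γ => pointwiseApply K E F (superposition f' γ), hB.comp (ih f' hf'),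
      fun γ => hasFDerivAt_superposition f f' hd γ⟩

end Nemytskii

/-! ### Local flows from the implicit function theorem -/

section Flow

open Set Filter Topology Metric unitInterval
open scoped NNReal

variable {E : Type*} [NormedAddCommGroup E] [NormedSpace ℝ E] [CompleteSpace E]

/-- The integral operator `γ ↦ (s ↦ ∫ τ in 0..s, γ τ)` on `C([0, 1], E)`. -/
noncomputable def primitiveCLM (E : Type*) [NormedAddCommGroup E] [NormedSpace ℝ E]
    [CompleteSpace E] : C(I, E) →L[ℝ] C(I, E) :=
  LinearMap.mkContinuous
    { toFun := fun γ => ⟨fun s => ∫ τ in (0 : ℝ)..s, γ (projIcc 0 1 zero_le_one τ), by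
        have hc : Continuous fun τ : ℝ => γ (projIcc 0 1 zero_le_one τ) := by fun_prop
        exact (intervalIntegral.continuous_primitive
          (fun a b => hc.intervalIntegrable a b) 0).comp continuous_subtype_val⟩
      map_add' := fun γ δ => by
        ext s
        have hc : ∀ γ : C(I, E), Continuous fun τ : ℝ => γ (projIcc 0 1 zero_le_one τ) :=
          fun γ => by fun_prop
        exact intervalIntegral.integral_add ((hc γ).intervalIntegrable _ _)
          ((hc δ).intervalIntegrable _ _)
      map_smul' := fun c γ => by
        ext s
        exact intervalIntegral.integral_smul _ _ } 1 (fun γ => by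
      rw [one_mul, ContinuousMap.norm_le _ (norm_nonneg _)]
      intro s
      refine (intervalIntegral.norm_integral_le_of_norm_le_const
        (fun τ _ => γ.norm_coe_le_norm _)).trans ?_
      rw [sub_zero, abs_of_nonneg s.2.1]
      exact mul_le_of_le_one_right (norm_nonneg _) s.2.2)

lemma norm_primitiveCLM_le : ‖primitiveCLM E‖ ≤ 1 :=
  LinearMap.mkContinuous_norm_le _ zero_le_one _

/-- The Picard operator of the equation `γ' = t f(γ)`, `γ 0 = x` on `[0, 1]`. -/
noncomputable def picardMap (f : C(E, E)) (t : ℝ) (x : E) (γ : C(I, E)) : C(I, E) :=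
  ContinuousMap.const I x + t • primitiveCLM E (superposition f γ)

lemma picardMap_apply (f : C(E, E)) (t : ℝ) (x : E) (γ : C(I, E)) (s : I) :
    picardMap f t x γ s = x + t • ∫ τ in (0 : ℝ)..s, f (γ (projIcc 0 1 zero_le_one τ)) := rfl

lemma lipschitzWith_picardMap {f : C(E, E)} {L : ℝ≥0} (hf : LipschitzWith L f) (t : ℝ) (x : E) :
    LipschitzWith (‖t‖₊ * L) (picardMap f t x) := by
  refine LipschitzWith.of_dist_le_mul fun γ δ => ?_
  rw [picardMap, picardMap, dist_add_left, dist_eq_norm, ← smul_sub, norm_smul, ← map_sub,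
    NNReal.coe_mul, mul_assoc, coe_nnnorm]
  gcongr
  refine ((primitiveCLM E).le_of_opNorm_le norm_primitiveCLM_le _).trans ?_
  rw [one_mul, ContinuousMap.norm_le _ (by positivity)]
  intro s
  rw [ContinuousMap.sub_apply, ← dist_eq_norm]
  exact (hf.dist_le_mul _ _).trans (by gcongr; exact ContinuousMap.dist_apply_le_dist s)

lemma contractingWith_picardMap {f : C(E, E)} {L : ℝ≥0} (hf : LipschitzWith L f) {t : ℝ}
    (ht : ‖t‖₊ * L < 1) (x : E) : ContractingWith (‖t‖₊ * L) (picardMap f t x) :=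
  ⟨ht, lipschitzWith_picardMap hf t x⟩

/-- The solution of `γ' = t f(γ)`, `γ 0 = x` on `[0, 1]`, for small `t`. -/
noncomputable def picardSolution (f : C(E, E)) (t : ℝ) (x : E) : C(I, E) :=
  Classical.epsilon fun γ => picardMap f t x γ = γ

lemma picardMap_picardSolution {f : C(E, E)} {L : ℝ≥0} (hf : LipschitzWith L f) {t : ℝ}
    (ht : ‖t‖₊ * L < 1) (x : E) :
    picardMap f t x (picardSolution f t x) = picardSolution f t x :=
  Classical.epsilon_spec (p := fun γ => picardMap f t x γ = γ)
    ⟨_, (contractingWith_picardMap hf ht x).fixedPoint_isFixedPt⟩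

lemma eq_picardSolution {f : C(E, E)} {L : ℝ≥0} (hf : LipschitzWith L f) {t : ℝ}
    (ht : ‖t‖₊ * L < 1) {x : E} {γ : C(I, E)} (h : picardMap f t x γ = γ) :
    γ = picardSolution f t x :=
  (contractingWith_picardMap hf ht x).fixedPoint_unique' h (picardMap_picardSolution hf ht x)

/-- If `γ` solves the problem with factor `t`, then `r ↦ γ (r s)` solves it with factor `s t`;
uniqueness does the rest. The whole trajectory can thus be read off from the values at `1`. -/
lemma picardSolution_rescale {f : C(E, E)} {L : ℝ≥0} (hf : LipschitzWith L f) {t : ℝ}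
    (ht : ‖t‖₊ * L < 1) (x : E) (s : I) :
    picardSolution f t x s = picardSolution f (s * t) x 1 := by
  have hst : ‖(s : ℝ) * t‖₊ * L < 1 := by
    refine lt_of_le_of_lt ?_ ht
    gcongr
    rw [nnnorm_mul]
    refine mul_le_of_le_one_left zero_le ?_
    rw [← NNReal.coe_le_coe, coe_nnnorm, Real.norm_eq_abs, abs_of_nonneg s.2.1]
    exact s.2.2
  let γ : C(I, E) := ⟨fun r => picardSolution f t x (r * s), by fun_prop⟩
  have hγ : picardMap f (s * t) x γ = γ := by
    ext r
    rw [picardMap_apply]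
    change _ = picardSolution f t x (r * s)
    conv_rhs => rw [← picardMap_picardSolution hf ht x, picardMap_apply]
    congr 1
    have h1 : ∀ τ ∈ uIcc (0 : ℝ) r, f (γ (projIcc 0 1 zero_le_one τ)) =
        f (picardSolution f t x (projIcc 0 1 zero_le_one (s * τ))) := by
      intro τ hτ
      rw [uIcc_of_le r.2.1] at hτ
      have hτ1 : τ ∈ Icc (0 : ℝ) 1 := ⟨hτ.1, hτ.2.trans r.2.2⟩
      have hτ2 : (s : ℝ) * τ ∈ Icc (0 : ℝ) 1 :=
        ⟨mul_nonneg s.2.1 hτ.1, mul_le_one₀ s.2.2 hτ1.1 hτ1.2⟩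
      congr 1
      change picardSolution f t x (_ * s) = _
      congr 1
      rw [projIcc_of_mem _ hτ1, projIcc_of_mem _ hτ2]
      ext
      simp [mul_comm]
    rw [intervalIntegral.integral_congr h1, mul_comm, mul_smul,
      intervalIntegral.smul_integral_comp_mul_left
        (fun τ => f (picardSolution f t x (projIcc 0 1 zero_le_one τ)))]
    simp [mul_comm]
  rw [← eq_picardSolution hf hst hγ]
  change _ = picardSolution f t x (1 * s)
  rw [one_mul]

lemma contDiff_picardMap (n : ℕ) (f : C(E, E)) (hf : ContDiff ℝ n f) :
    ContDiff ℝ n fun p : (ℝ × E) × C(I, E) => picardMap f p.1.1 p.1.2 p.2 := by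
  have h1 := contDiff_superposition (K := I) n f hf
  have h2 : ContDiff ℝ n fun x : E => ContinuousMap.const I x :=
    (ContinuousLinearMap.const ℝ I : E →L[ℝ] C(I, E)).contDiff
  unfold picardMap
  fun_prop

lemma fderiv_superposition_norm_le {F : Type*} [NormedAddCommGroup F] [NormedSpace ℝ F]
    {f : C(F, F)} {L : ℝ≥0} (hf : LipschitzWith L f) (γ : C(I, F)) : ‖fderiv ℝ (superposition (K := I) f) γ‖ ≤ L := by
  refine norm_fderiv_le_of_lipschitz ℝ (LipschitzWith.of_dist_le_mul fun γ δ => ?_)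
  rw [ContinuousMap.dist_le (by positivity)]
  intro s
  exact (hf.dist_le_mul _ _).trans (by gcongr; exact ContinuousMap.dist_apply_le_dist s)

lemma isInvertible_id_sub_smul_comp {X : Type*} [NormedAddCommGroup X] [NormedSpace ℝ X]
    [CompleteSpace X] {P Q : X →L[ℝ] X} {t L : ℝ} (hP : ‖P‖ ≤ 1) (hQ : ‖Q‖ ≤ L)
    (ht : ‖t‖ * L < 1) : (ContinuousLinearMap.id ℝ X - t • P.comp Q).IsInvertible := by
  have hnorm : ‖t • P.comp Q‖ < 1 := by
    refine lt_of_le_of_lt ?_ ht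
    rw [norm_smul]
    gcongr
    refine (ContinuousLinearMap.opNorm_comp_le _ _).trans ?_
    calc _ ≤ 1 * L := by gcongr
      _ = L := one_mul _
  obtain ⟨w, hw⟩ := isUnit_one_sub_of_norm_lt_one hnorm
  exact ⟨ContinuousLinearEquiv.ofUnit w, hw⟩

/-- The solution is the zero of `γ - picardMap f t x γ`. The partial derivative in `γ` is the
identity minus an operator of norm less than `1`, so the implicit function theorem applies, and
uniqueness of fixed points identifies the implicit function. -/
lemma contDiffAt_picardSolution (n : ℕ) (hn : n ≠ 0) {f : C(E, E)} (hfn : ContDiff ℝ n f)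
    {L : ℝ≥0} (hf : LipschitzWith L f) {t : ℝ} (ht : ‖t‖₊ * L < 1) (x : E) :
    ContDiffAt ℝ n (fun p : ℝ × E => picardSolution f p.1 p.2) (t, x) := by
  set G : (ℝ × E) × C(I, E) → C(I, E) := fun p => p.2 - picardMap f p.1.1 p.1.2 p.2 with hG
  have hn' : (n : WithTop ℕ∞) ≠ 0 := by exact_mod_cast hn
  have hGs : ContDiff ℝ n G := contDiff_snd.sub (contDiff_picardMap n f hfn)
  set u : (ℝ × E) × C(I, E) := ((t, x), picardSolution f t x) with hu
  have hcd : ContDiffAt ℝ n G u := hGs.contDiffAt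
  set A : C(I, E) →L[ℝ] C(I, E) :=
    t • (primitiveCLM E).comp (fderiv ℝ (superposition (K := I) f) u.2) with hA
  have hpart : fderiv ℝ G u ∘L .inr ℝ (ℝ × E) C(I, E) = .id ℝ _ - A := by
    have h1 : HasFDerivAt (fun γ => G (u.1, γ))
        (fderiv ℝ G u ∘L .inr ℝ (ℝ × E) C(I, E)) u.2 := by
      have hd : HasFDerivAt G (fderiv ℝ G u) (u.1, u.2) :=
        ((hGs.differentiable hn') u).hasFDerivAt
      exact hd.comp u.2 (hasFDerivAt_prodMk_right u.1 u.2)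
    have h2 : HasFDerivAt (fun γ => G (u.1, γ)) (.id ℝ _ - A) u.2 := by
      have hs : HasFDerivAt (superposition (K := I) f)
          (fderiv ℝ (superposition (K := I) f) u.2) u.2 :=
        ((contDiff_superposition n f hfn).differentiable hn' _).hasFDerivAt
      exact (hasFDerivAt_id _).sub
        ((((primitiveCLM E).hasFDerivAt.comp u.2 hs).const_smul t).const_add
          (ContinuousMap.const I x))
    exact h1.unique h2
  have hinv : (fderiv ℝ G u ∘L .inr ℝ (ℝ × E) C(I, E)).IsInvertible := by
    rw [hpart]
    refine isInvertible_id_sub_smul_comp norm_primitiveCLM_le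
      (fderiv_superposition_norm_le hf u.2) ?_
    exact_mod_cast ht
  refine (hcd.contDiffAt_implicitFunction hn' hinv).congr_of_eventuallyEq ?_
  have hopen : ∀ᶠ p : ℝ × E in 𝓝 u.1, ‖p.1‖₊ * L < 1 := by
    have hc : Continuous fun p : ℝ × E => ‖p.1‖₊ * L := by fun_prop
    exact hc.continuousAt.eventually_lt continuousAt_const ht
  filter_upwards [hcd.eventually_apply_implicitFunction hn' hinv, hopen] with p hp hp1
  refine (eq_picardSolution hf hp1 ?_).symm
  have h0 : G u = 0 := sub_eq_zero.2 (picardMap_picardSolution hf ht x).symm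
  rw [h0] at hp
  exact (sub_eq_zero.1 hp).symm

/-- `Φ` is a local flow of the vector field `f`, of class `C²` and defined for all times in
`(-ε, ε)`. -/
structure IsLocalFlow (f : E → E) (ε : ℝ) (Φ : ℝ → E → E) : Prop where
  contDiffAt : ∀ t ∈ Ioo (-ε) ε, ∀ x, ContDiffAt ℝ 2 (fun p : ℝ × E => Φ p.1 p.2) (t, x)
  zero : ∀ x, Φ 0 x = x
  hasDerivAt : ∀ t ∈ Ioo (-ε) ε, ∀ x, HasDerivAt (fun s => Φ s x) (f (Φ t x)) t

lemma IsLocalFlow.mono {F : Type*} [NormedAddCommGroup F] [NormedSpace ℝ F] {f : F → F}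
    {ε ε' : ℝ} {Φ : ℝ → F → F} (h : IsLocalFlow f ε Φ)
    (hε : ε' ≤ ε) : IsLocalFlow f ε' Φ where
  contDiffAt t ht := h.contDiffAt t ⟨by linarith [ht.1], by linarith [ht.2]⟩
  zero := h.zero
  hasDerivAt t ht := h.hasDerivAt t ⟨by linarith [ht.1], by linarith [ht.2]⟩

/-- A Lipschitz vector field of class `C²` has a local flow of class `C²`. -/
theorem exists_isLocalFlow {f : E → E} (hf2 : ContDiff ℝ 2 f) {L : ℝ≥0} (hf : LipschitzWith L f) :
    ∃ ε > 0, ∃ Φ : ℝ → E → E, IsLocalFlow f ε Φ := by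
  let g : C(E, E) := ⟨f, hf2.continuous⟩
  -- For `|t| < 1 / (L + 1)` the Picard operator is a contraction.
  have hε : 0 < 1 / ((L : ℝ) + 1) := by positivity
  have hsmall : ∀ t ∈ Ioo (-(1 / ((L : ℝ) + 1))) (1 / ((L : ℝ) + 1)), ‖t‖₊ * L < 1 := by
    intro t ht
    rw [← NNReal.coe_lt_coe, NNReal.coe_mul, coe_nnnorm, Real.norm_eq_abs, NNReal.coe_one]
    have h1 := abs_lt.2 ht
    rw [lt_div_iff₀ (by positivity)] at h1
    have := L.coe_nonneg
    nlinarith [abs_nonneg t]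
  have hcd : ∀ t ∈ Ioo (-(1 / ((L : ℝ) + 1))) (1 / ((L : ℝ) + 1)), ∀ x,
      ContDiffAt ℝ 2 (fun p : ℝ × E => picardSolution g p.1 p.2 1) (t, x) := by
    intro t ht x
    have hev : ContDiff ℝ 2 fun γ : C(I, E) => γ 1 :=
      (ContinuousMap.evalCLM ℝ (1 : I) : C(I, E) →L[ℝ] E).contDiff
    exact hev.contDiffAt.comp (t, x)
      (contDiffAt_picardSolution (f := g) 2 two_ne_zero hf2 hf (hsmall t ht) x)
  -- Rescaling turns the fixed point equation at `s = 1` into the integral equation in the variable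
  -- `t`.
  have hint : ∀ t ∈ Ioo (-(1 / ((L : ℝ) + 1))) (1 / ((L : ℝ) + 1)), ∀ x,
      picardSolution g t x 1 = x + ∫ τ in (0 : ℝ)..t, f (picardSolution g τ x 1) := by
    intro t ht x
    conv_lhs => rw [← picardMap_picardSolution hf (hsmall t ht) x, picardMap_apply]
    congr 1
    have h1 : ∀ τ ∈ uIcc (0 : ℝ) (1 : I),
        g (picardSolution g t x (projIcc 0 1 zero_le_one τ)) =
        f (picardSolution g (t * τ) x 1) := by
      intro τ hτ
      rw [Icc.coe_one, uIcc_of_le zero_le_one] at hτ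
      rw [picardSolution_rescale hf (hsmall t ht), projIcc_of_mem _ hτ, mul_comm]
      rfl
    rw [intervalIntegral.integral_congr h1,
      intervalIntegral.smul_integral_comp_mul_left (fun τ => f (picardSolution g τ x 1))]
    simp
  refine ⟨1 / (L + 1), hε, fun t x => picardSolution g t x 1, hcd, fun x => ?_, fun t ht x => ?_⟩
  · simpa using hint 0 ⟨by linarith, hε⟩ x
  · have hcont : ContinuousOn (fun τ => f (picardSolution g τ x 1))
        (Ioo (-(1 / ((L : ℝ) + 1))) (1 / ((L : ℝ) + 1))) := by
      intro τ hτ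
      have h2 : ContinuousAt (fun τ => picardSolution g τ x 1) τ :=
        (hcd τ hτ x).continuousAt.comp (f := fun τ : ℝ => (τ, x)) (by fun_prop)
      exact (hf2.continuous.continuousAt.comp h2).continuousWithinAt
    have hsub : uIcc 0 t ⊆ Ioo (-(1 / ((L : ℝ) + 1))) (1 / ((L : ℝ) + 1)) :=
      ordConnected_Ioo.uIcc_subset (mem_Ioo.2 ⟨by linarith, hε⟩) ht
    have h3 := intervalIntegral.integral_hasDerivAt_right
      ((hcont.mono hsub).intervalIntegrable)
      (hcont.stronglyMeasurableAtFilter isOpen_Ioo t ht)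
      (hcont.continuousAt (isOpen_Ioo.mem_nhds ht))
    refine (h3.const_add x).congr_of_eventuallyEq ?_
    filter_upwards [isOpen_Ioo.mem_nhds ht] with s hs
    exact hint s hs x

end Flow

/-! ### Differential calculus of local flows -/

section LocalFlow

open Set Filter Topology Metric
open scoped NNReal

variable {E : Type*} [NormedAddCommGroup E] [NormedSpace ℝ E] {f : E → E} {ε : ℝ}
  {Φ : ℝ → E → E}

namespace IsLocalFlow

lemma differentiableAt_apply (h : IsLocalFlow f ε Φ) {t : ℝ} (ht : t ∈ Ioo (-ε) ε) (x : E) :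
    DifferentiableAt ℝ (Φ t) x :=
  ((h.contDiffAt t ht x).differentiableAt (by simp)).comp x (f := fun x => (t, x)) (by fun_prop)

lemma fderiv_inr (h : IsLocalFlow f ε Φ) {t : ℝ} (ht : t ∈ Ioo (-ε) ε) (x : E) :
    fderiv ℝ (fun p : ℝ × E => Φ p.1 p.2) (t, x) ∘L .inr ℝ ℝ E = fderiv ℝ (Φ t) x := by
  have hd : HasFDerivAt (fun p : ℝ × E => Φ p.1 p.2)
      (fderiv ℝ (fun p : ℝ × E => Φ p.1 p.2) (t, x)) (t, x) :=
    ((h.contDiffAt t ht x).differentiableAt (by simp)).hasFDerivAt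
  exact ((hd.comp x (hasFDerivAt_prodMk_right t x)).fderiv).symm

lemma fderiv_fst (h : IsLocalFlow f ε Φ) {t : ℝ} (ht : t ∈ Ioo (-ε) ε) (x : E) :
    fderiv ℝ (fun p : ℝ × E => Φ p.1 p.2) (t, x) (1, 0) = f (Φ t x) := by
  have hd : HasFDerivAt (fun p : ℝ × E => Φ p.1 p.2)
      (fderiv ℝ (fun p : ℝ × E => Φ p.1 p.2) (t, x)) (t, x) :=
    ((h.contDiffAt t ht x).differentiableAt (by simp)).hasFDerivAt
  have h1 : HasDerivAt (fun s : ℝ => (s, x)) (1, 0) t :=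
    (hasDerivAt_id t).prodMk (hasDerivAt_const t x)
  exact (HasFDerivAt.comp_hasDerivAt (f := fun s : ℝ => (s, x)) t hd h1).unique
    (h.hasDerivAt t ht x)

lemma hasStrictFDerivAt (h : IsLocalFlow f ε Φ) {t : ℝ} (ht : t ∈ Ioo (-ε) ε) (x : E) :
    HasStrictFDerivAt (fun p : ℝ × E => Φ p.1 p.2)
      ((ContinuousLinearMap.fst ℝ ℝ E).smulRight (f (Φ t x)) +
        (fderiv ℝ (Φ t) x).comp (ContinuousLinearMap.snd ℝ ℝ E)) (t, x) := by
  have h1 := (h.contDiffAt t ht x).hasStrictFDerivAt (by simp)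
  have h2 : fderiv ℝ (fun p : ℝ × E => Φ p.1 p.2) (t, x) =
      (ContinuousLinearMap.fst ℝ ℝ E).smulRight (f (Φ t x)) +
        (fderiv ℝ (Φ t) x).comp (ContinuousLinearMap.snd ℝ ℝ E) := by
    ext p
    · simp [h.fderiv_fst ht]
    · simp [← h.fderiv_inr ht]
  rwa [h2] at h1

/-- The curves `s ↦ Φ (s - t) (Φ t x)` and `s ↦ Φ s x` solve the same equation and agree at `s = t`;
compare them at `s = 0`. -/
lemma apply_neg_apply (h : IsLocalFlow f ε Φ) {K : ℝ≥0} (hf : LipschitzWith K f) {t : ℝ}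
    (ht : t ∈ Ioo (-ε) ε) (x : E) : Φ (-t) (Φ t x) = x := by
  have hε : 0 < ε := by linarith [ht.1, ht.2]
  have hmem : ∀ s, s ∈ Ioo (max (-ε) (t - ε)) (min ε (t + ε)) →
      s ∈ Ioo (-ε) ε ∧ s - t ∈ Ioo (-ε) ε := by
    intro s hs
    simp only [mem_Ioo, max_lt_iff, lt_min_iff] at hs ⊢
    constructor <;> constructor <;> linarith
  have hEq := ODE_solution_unique_of_mem_Ioo (v := fun _ => f) (s := fun _ => univ)
    (f := fun s => Φ (s - t) (Φ t x)) (g := fun s => Φ s x) (K := K)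
    (a := max (-ε) (t - ε)) (b := min ε (t + ε)) (t₀ := t)
    (fun _ _ => hf.lipschitzOnWith) (by
      simp only [mem_Ioo, max_lt_iff, lt_min_iff]
      refine ⟨⟨ht.1, by linarith⟩, ht.2, by linarith⟩)
    (fun s hs => ⟨(h.hasDerivAt (s - t) (hmem s hs).2 (Φ t x)).comp_sub_const s t, mem_univ _⟩)
    (fun s hs => ⟨h.hasDerivAt s (hmem s hs).1 x, mem_univ _⟩) (by simp [h.zero])
  have h0 := hEq (x := 0) (by
    simp only [mem_Ioo, max_lt_iff, lt_min_iff]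
    refine ⟨⟨by linarith, by linarith [ht.2]⟩, hε, by linarith [ht.1]⟩)
  simpa [h.zero] using h0

lemma neg_mem {t ε : ℝ} (ht : t ∈ Ioo (-ε) ε) : -t ∈ Ioo (-ε) ε :=
  ⟨by linarith [ht.2], by linarith [ht.1]⟩

lemma fderiv_neg_comp_fderiv (h : IsLocalFlow f ε Φ) {K : ℝ≥0} (hf : LipschitzWith K f) {t : ℝ}
    (ht : t ∈ Ioo (-ε) ε) (x : E) :
    fderiv ℝ (Φ (-t)) (Φ t x) ∘L fderiv ℝ (Φ t) x = .id ℝ E := by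
  have h1 := (h.differentiableAt_apply (neg_mem ht) (Φ t x)).hasFDerivAt.comp x
    (h.differentiableAt_apply ht x).hasFDerivAt
  have h2 : Φ (-t) ∘ Φ t = id := funext fun y => h.apply_neg_apply hf ht y
  rw [h2] at h1
  exact h1.unique (hasFDerivAt_id x)

lemma fderiv_comp_fderiv_neg (h : IsLocalFlow f ε Φ) {K : ℝ≥0} (hf : LipschitzWith K f) {t : ℝ}
    (ht : t ∈ Ioo (-ε) ε) (x : E) :
    fderiv ℝ (Φ t) x ∘L fderiv ℝ (Φ (-t)) (Φ t x) = .id ℝ E := by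
  have h1 := h.fderiv_neg_comp_fderiv hf (neg_mem ht) (Φ t x)
  rwa [neg_neg, h.apply_neg_apply hf ht] at h1

lemma dist_apply_le (h : IsLocalFlow f ε Φ) {C : ℝ} (hC : ∀ x, ‖f x‖ ≤ C) {t : ℝ} (ht0 : 0 ≤ t)
    (htε : t < ε) (x : E) : dist (Φ t x) x ≤ C * t := by
  have h1 := norm_image_sub_le_of_norm_deriv_le_segment' (f := fun s => Φ s x) (a := 0) (b := t)
    (f' := fun s => f (Φ s x)) (C := C)
    (fun s hs => (h.hasDerivAt s ⟨by linarith [hs.1], by linarith [hs.2]⟩ x).hasDerivWithinAt)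
    (fun s _ => hC _) t ⟨ht0, le_rfl⟩
  simpa [h.zero, dist_eq_norm] using h1

/-- The Lie derivative of a vector field `v` along the flow of `f` is the Lie bracket `[f, v]`. -/
lemma hasDerivAt_pullback (h : IsLocalFlow f ε Φ) (hε : 0 < ε) {v : E → E} {z : E}
    (hv : DifferentiableAt ℝ v z) :
    HasDerivAt (fun s => fderiv ℝ (Φ (-s)) (Φ s z) (v (Φ s z)))
      (VectorField.lieBracket ℝ f v z) 0 := by
  set Ψ : ℝ × E → E := fun p => Φ p.1 p.2 with hΨ
  have h0 : (0 : ℝ) ∈ Ioo (-ε) ε := ⟨by linarith, hε⟩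
  have hcd : ContDiffAt ℝ 2 Ψ (0, z) := h.contDiffAt 0 h0 z
  have hsymm : IsSymmSndFDerivAt ℝ Ψ (0, z) := hcd.isSymmSndFDerivAt (by simp)
  have hΨ' : HasFDerivAt (fderiv ℝ Ψ) (fderiv ℝ (fderiv ℝ Ψ) (0, z)) (0, z) :=
    ((hcd.fderiv_right (m := 1) (by norm_num)).differentiableAt (by simp)).hasFDerivAt
  set D2 := fderiv ℝ (fderiv ℝ Ψ) (0, z) with hD2
  -- At time `0` the time derivative is `f` and the space derivative is the identity. Differentiated
  -- in space, these give the mixed second derivative `Df` and a vanishing pure second derivative.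
  have htime : ∀ y, fderiv ℝ Ψ (0, y) (1, 0) = f y := fun y => by
    rw [h.fderiv_fst h0, h.zero]
  have hspace : ∀ y w, fderiv ℝ Ψ (0, y) (0, w) = w := by
    intro y w
    have h1 := DFunLike.congr_fun (h.fderiv_inr h0 y) w
    have h2 : Φ 0 = id := funext h.zero
    rw [h2, fderiv_id] at h1
    simpa using h1
  have hx : HasFDerivAt (fun y : E => fderiv ℝ Ψ (0, y)) (D2 ∘L .inr ℝ ℝ E) z :=
    hΨ'.comp z (hasFDerivAt_prodMk_right 0 z)
  have hmixed : ∀ w, D2 (0, w) (1, 0) = fderiv ℝ f z w := by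
    intro w
    have h1 := (hx.clm_apply (hasFDerivAt_const ((1 : ℝ), (0 : E)) z))
    simp only [htime] at h1
    rw [h1.fderiv]
    simp
  have hpure : ∀ w w', D2 (0, w) (0, w') = 0 := by
    intro w w'
    have h1 := (hx.clm_apply (hasFDerivAt_const ((0 : ℝ), w') z))
    simp only [hspace] at h1
    have h2 := DFunLike.congr_fun (h1.unique (hasFDerivAt_const w' z)) w
    simpa using h2
  have hflow : HasDerivAt (fun s => Φ s z) (f z) 0 := by
    simpa [h.zero] using h.hasDerivAt 0 h0 z
  have hcurve : HasDerivAt (fun s : ℝ => (-s, Φ s z)) (-1, f z) 0 :=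
    (hasDerivAt_neg 0).prodMk hflow
  have hB : HasDerivAt (fun s : ℝ => fderiv ℝ Ψ (-s, Φ s z)) (D2 (-1, f z)) 0 :=
    HasFDerivAt.comp_hasDerivAt (x := (0 : ℝ)) (f := fun s : ℝ => (-s, Φ s z))
      (by simpa [h.zero] using hΨ') hcurve
  have hvc : HasDerivAt (fun s => v (Φ s z)) (fderiv ℝ v z (f z)) 0 :=
    HasFDerivAt.comp_hasDerivAt (x := (0 : ℝ)) (f := fun s : ℝ => Φ s z)
      (by simpa [h.zero] using hv.hasFDerivAt) hflow
  have hpair : HasDerivAt (fun s => ((0 : ℝ), v (Φ s z))) (0, fderiv ℝ v z (f z)) 0 :=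
    (hasDerivAt_const _ _).prodMk hvc
  have hmain := hB.clm_apply hpair
  -- Along the curve `(-s, Φ s z)` the chain rule gives `Dv (f z) - Df (v z)`; symmetry of the
  -- second derivative brings the mixed term into the computed form.
  have hval : D2 (-1, f z) (0, v (Φ 0 z)) +
      fderiv ℝ Ψ (-0, Φ 0 z) (0, fderiv ℝ v z (f z)) = VectorField.lieBracket ℝ f v z := by
    rw [h.zero, neg_zero, hspace, VectorField.lieBracket]
    have h1 : ((-1 : ℝ), f z) = -((1 : ℝ), (0 : E)) + (0, f z) := by simp
    rw [h1, map_add, map_neg, add_apply, neg_apply,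
      hsymm.eq, hmixed, hpure]
    abel
  rw [hval] at hmain
  refine hmain.congr_of_eventuallyEq ?_
  filter_upwards [isOpen_Ioo.mem_nhds h0] with s hs
  rw [← h.fderiv_inr (neg_mem hs)]
  rfl

end IsLocalFlow

end LocalFlow

/-! ### Directions attained by switching flows -/

section Accessibility

open Set Filter Topology Metric
open scoped NNReal

variable {E ι : Type*}

/-- The point reached from `x` at the end of the first `m` stays, together with the elapsed time,
if the flows `w 0, w 1, …` are followed in turn for the times `s 0, s 1, …`. -/
def endpoint (Φ : ι → ℝ → E → E) (x : E) (w : ℕ → ι) : (m : ℕ) → (Fin m → ℝ) → E × ℝ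
  | 0, _ => (x, 0)
  | m + 1, s => (Φ (w m) (s (Fin.last m)) (endpoint Φ x w m (Fin.init s)).1,
      (endpoint Φ x w m (Fin.init s)).2 + s (Fin.last m))

lemma endpoint_congr (Φ : ι → ℝ → E → E) (x : E) {w w' : ℕ → ι} {m : ℕ}
    (h : ∀ l < m, w l = w' l) : endpoint Φ x w m = endpoint Φ x w' m := by
  induction m with
  | zero => rfl
  | succ m ih =>
    funext s
    simp only [endpoint, ih fun l hl => h l (by omega), h m (by omega)]

lemma endpoint_snd (Φ : ι → ℝ → E → E) (x : E) (w : ℕ → ι) {m : ℕ} (s : Fin m → ℝ) :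
    (endpoint Φ x w m s).2 = ∑ l, s l := by
  induction m with
  | zero => simp [endpoint]
  | succ m ih => simp only [endpoint, ih, Fin.sum_univ_castSucc]; rfl

lemma sum_eq_of_endpoint_eq {Φ : ι → ℝ → E → E} {x y : E} {T : ℝ} {w : ℕ → ι} {m : ℕ}
    {s : Fin m → ℝ} (h : endpoint Φ x w m s = (y, T)) : ∑ l, s l = T := by
  rw [← endpoint_snd Φ x w s, h]

lemma endpoint_snoc (Φ : ι → ℝ → E → E) (x : E) (w : ℕ → ι) (j : ι) (m : ℕ) (s : Fin m → ℝ)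
    (τ : ℝ) :
    endpoint Φ x (Function.update w m j) (m + 1) (Fin.snoc s τ) =
      (Φ j τ (endpoint Φ x w m s).1, (endpoint Φ x w m s).2 + τ) := by
  have h1 : endpoint Φ x (Function.update w m j) m = endpoint Φ x w m :=
    endpoint_congr Φ x fun l hl => Function.update_of_ne hl.ne _ _
  simp [endpoint, h1]

variable [NormedAddCommGroup E] [NormedSpace ℝ E]

/-- The configuration `(y, T)` is reached from `x` by a sequence of flows which begins with the
flow `i`, ends with the flow `a` and never repeats a flow immediately; the derivative with respect
to the switching times has the range `V`. -/
def Attains (Φ : ι → ℝ → E → E) (x : E) (i a : ι) (T : ℝ) (y : E) (V : Submodule ℝ (E × ℝ)) :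
    Prop :=
  ∃ (m : ℕ) (w : ℕ → ι) (s : Fin (m + 1) → ℝ) (A : (Fin (m + 1) → ℝ) →L[ℝ] E × ℝ),
    w 0 = i ∧ (∀ l < m, w l ≠ w (l + 1)) ∧ w m = a ∧ (∀ l, 0 ≤ s l) ∧
    endpoint Φ x w (m + 1) s = (y, T) ∧ HasStrictFDerivAt (endpoint Φ x w (m + 1)) A s ∧
    A.range = V

variable {f : ι → E → E} {Φ : ι → ℝ → E → E} {ε : ℝ}

/-- By the chain rule, the earlier directions are carried along by the differential of the last
flow, with their time components unchanged, and varying the last stay adds the direction `(f, 1)`.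
-/
lemma hasStrictFDerivAt_endpoint_succ (hΦ : ∀ j, IsLocalFlow (f j) ε (Φ j)) {x : E} {w : ℕ → ι}
    {m : ℕ} {s : Fin (m + 1) → ℝ} {A : (Fin m → ℝ) →L[ℝ] E × ℝ}
    (hA : HasStrictFDerivAt (endpoint Φ x w m) A (Fin.init s))
    (hs : s (Fin.last m) ∈ Ioo (-ε) ε) :
    ∃ A' : (Fin (m + 1) → ℝ) →L[ℝ] E × ℝ, HasStrictFDerivAt (endpoint Φ x w (m + 1)) A' s ∧
      ∀ σ τ, A' (Fin.snoc σ τ) =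
        (fderiv ℝ (Φ (w m) (s (Fin.last m))) (endpoint Φ x w m (Fin.init s)).1).prodMap
          (.id ℝ ℝ) (A σ) + τ • (f (w m) (endpoint Φ x w (m + 1) s).1, (1 : ℝ)) := by
  let P : (Fin (m + 1) → ℝ) →L[ℝ] (Fin m → ℝ) :=
    ContinuousLinearMap.pi fun l => ContinuousLinearMap.proj l.castSucc
  let Q : (Fin (m + 1) → ℝ) →L[ℝ] ℝ := ContinuousLinearMap.proj (Fin.last m)
  have hP : HasStrictFDerivAt (fun s : Fin (m + 1) → ℝ => endpoint Φ x w m (Fin.init s))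
      (A ∘L P) s := hA.comp s P.hasStrictFDerivAt
  have hQ : HasStrictFDerivAt (fun s : Fin (m + 1) → ℝ => s (Fin.last m)) Q s :=
    Q.hasStrictFDerivAt
  have h1 := HasStrictFDerivAt.comp
    (f := fun s : Fin (m + 1) → ℝ => (s (Fin.last m), (endpoint Φ x w m (Fin.init s)).1)) s
    ((hΦ (w m)).hasStrictFDerivAt hs (endpoint Φ x w m (Fin.init s)).1) (hQ.prodMk hP.fst)
  refine ⟨_, h1.prodMk (hP.snd.add hQ), fun σ τ => ?_⟩
  have hPs : P (Fin.snoc σ τ) = σ := by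
    ext l
    simp [P]
  have hQs : Q (Fin.snoc σ τ) = τ := by simp [Q]
  ext
  · simp [hPs, hQs, endpoint, add_comm]
  · simp [hPs, hQs]

lemma dist_endpoint_le (hΦ : ∀ j, IsLocalFlow (f j) ε (Φ j)) {C : ℝ} (hC : ∀ j x, ‖f j x‖ ≤ C)
    (x : E) (w : ℕ → ι) {m : ℕ} (s : Fin m → ℝ) (hs : ∀ l, 0 ≤ s l) (hε : ∑ l, s l < ε) :
    dist (endpoint Φ x w m s).1 x ≤ C * ∑ l, s l := by
  induction m with
  | zero => simp [endpoint]
  | succ m ih =>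
    rw [Fin.sum_univ_castSucc] at hε ⊢
    have h0 : 0 ≤ ∑ l : Fin m, s l.castSucc := Finset.sum_nonneg fun l _ => hs _
    have h1 := ih (Fin.init s) (fun l => hs _)
      (lt_of_le_of_lt (le_add_of_nonneg_right (hs (Fin.last m))) hε)
    have h2 := (hΦ (w m)).dist_apply_le (hC (w m)) (hs (Fin.last m)) (by linarith)
      (endpoint Φ x w m (Fin.init s)).1
    calc _ ≤ _ := dist_triangle _ (endpoint Φ x w m (Fin.init s)).1 x
      _ ≤ _ := add_le_add h2 h1
      _ = _ := by
        rw [mul_add, add_comm]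
        rfl

namespace Attains

variable {x y : E} {i a j : ι} {T τ : ℝ} {V : Submodule ℝ (E × ℝ)}

lemma time_nonneg (h : Attains Φ x i a T y V) : 0 ≤ T := by
  obtain ⟨m, w, s, A, -, -, -, hs, he, -⟩ := h
  rw [← sum_eq_of_endpoint_eq he]
  exact Finset.sum_nonneg fun l _ => hs l

lemma dist_le (hΦ : ∀ j, IsLocalFlow (f j) ε (Φ j)) {C : ℝ} (hC : ∀ j x, ‖f j x‖ ≤ C)
    (hT : T < ε) (h : Attains Φ x i a T y V) : dist y x ≤ C * T := by
  obtain ⟨m, w, s, A, -, -, -, hs, he, -⟩ := h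
  have h1 := dist_endpoint_le hΦ hC x w s hs (by rwa [sum_eq_of_endpoint_eq he])
  rwa [sum_eq_of_endpoint_eq he, he] at h1

lemma start (hΦ : ∀ j, IsLocalFlow (f j) ε (Φ j)) (hε : 0 < ε) (x : E) (i : ι) :
    ∃ V, Attains Φ x i i 0 x V := by
  obtain ⟨A', hA', -⟩ := hasStrictFDerivAt_endpoint_succ hΦ (x := x) (w := fun _ => i) (m := 0)
    (s := 0) (A := 0) (hasStrictFDerivAt_const (x, (0 : ℝ)) _) ⟨by simpa using hε, hε⟩
  exact ⟨_, 0, fun _ => i, 0, A', rfl, by simp, rfl, by simp, by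
    simp [endpoint, (hΦ i).zero], hA', rfl⟩

lemma step_of_ne (hΦ : ∀ j, IsLocalFlow (f j) ε (Φ j)) (h : Attains Φ x i a T y V)
    (hj : a ≠ j) (hτ0 : 0 ≤ τ) (hτε : τ < ε) :
    ∃ V', Attains Φ x i j (T + τ) (Φ j τ y) V' ∧
      V.map ((fderiv ℝ (Φ j τ) y).prodMap (.id ℝ ℝ)).toLinearMap ≤ V' ∧
      (f j (Φ j τ y), (1 : ℝ)) ∈ V' := by
  obtain ⟨m, w, s, A, hw0, hw, hwm, hs, he, hA, rfl⟩ := h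
  set w' := Function.update w (m + 1) j with hw'
  have hww' : ∀ l ≤ m, w' l = w l := fun l hl => Function.update_of_ne (by omega) _ _
  have hwj : w' (m + 1) = j := Function.update_self _ _ _
  have hsn : endpoint Φ x w' (m + 1) = endpoint Φ x w (m + 1) :=
    endpoint_congr Φ x fun l hl => hww' l (by omega)
  have hend : endpoint Φ x w' (m + 2) (Fin.snoc s τ) = (Φ j τ y, T + τ) := by
    rw [endpoint_snoc, he]
  obtain ⟨A', hA', hA's⟩ := hasStrictFDerivAt_endpoint_succ hΦ (x := x) (w := w') (m := m + 1)
    (s := Fin.snoc s τ) (A := A) (by rw [hsn]; simpa using hA) (by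
      rw [Fin.snoc_last]
      exact ⟨by linarith, hτε⟩)
  rw [hend, Fin.snoc_last, Fin.init_snoc, hsn, he, hwj] at hA's
  refine ⟨A'.range, ⟨m + 1, w', Fin.snoc s τ, A', by rw [hww' 0 (by omega), hw0], ?_, hwj, ?_,
    hend, hA', rfl⟩, ?_, ?_⟩
  · intro l hl
    rcases Nat.lt_succ_iff_lt_or_eq.1 hl with hl | rfl
    · rw [hww' l hl.le, hww' (l + 1) hl]
      exact hw l hl
    · rw [hww' l le_rfl, hwj, hwm]
      exact hj
  · intro l
    refine Fin.lastCases ?_ (fun l => ?_) l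
    · simpa using hτ0
    · simpa using hs l
  · rintro _ ⟨_, ⟨σ, rfl⟩, rfl⟩
    exact ⟨Fin.snoc σ 0, by simpa [Prod.map] using hA's σ 0⟩
  · exact ⟨Fin.snoc 0 1, by simpa [Prod.map] using hA's 0 1⟩

/-- A repetition of the flow `a` is avoided by a stay of length `0` in another flow `b` in between,
which changes neither the point nor the time and loses no direction. -/
lemma step [Nontrivial ι] (hΦ : ∀ j, IsLocalFlow (f j) ε (Φ j)) (hε : 0 < ε)
    (h : Attains Φ x i a T y V) (j : ι) (hτ0 : 0 ≤ τ) (hτε : τ < ε) :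
    ∃ V', Attains Φ x i j (T + τ) (Φ j τ y) V' ∧
      V.map ((fderiv ℝ (Φ j τ) y).prodMap (.id ℝ ℝ)).toLinearMap ≤ V' ∧
      (f j (Φ j τ y), (1 : ℝ)) ∈ V' := by
  by_cases hj : a = j
  · obtain ⟨b, hb⟩ := exists_ne a
    obtain ⟨V₁, h₁, hV₁, -⟩ := h.step_of_ne hΦ hb.symm le_rfl hε
    rw [add_zero, (hΦ b).zero] at h₁
    have hid : Φ b 0 = id := funext (hΦ b).zero
    have hle : V ≤ V₁ := by
      intro p hp
      have := hV₁ (Submodule.mem_map_of_mem hp)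
      rw [hid, fderiv_id] at this
      simpa using this
    obtain ⟨V₂, h₂, hV₂, h₂'⟩ := h₁.step_of_ne hΦ (hj ▸ hb) hτ0 hτε
    exact ⟨V₂, h₂, (Submodule.map_mono hle).trans hV₂, h₂'⟩
  · exact h.step_of_ne hΦ hj hτ0 hτε

end Attains

/-- The configurations which are attained in time less than `δ` with a space of directions of the
largest possible dimension: their spaces of directions contain all the fields, and the fields that
are everywhere among the directions are stable under the Lie brackets with the given fields. -/
theorem exists_maximal_configurations [FiniteDimensional ℝ E] [Nontrivial ι]
    (hΦ : ∀ j, IsLocalFlow (f j) ε (Φ j)) {K : ι → ℝ≥0} (hf : ∀ j, LipschitzWith (K j) (f j))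
    {δ : ℝ} (hδ : 0 < δ) (hδε : δ ≤ ε) (x : E) (i : ι) :
    ∃ S : Set (E × Submodule ℝ (E × ℝ)), S.Nonempty ∧
      (∀ c ∈ S, ∃ a, ∃ T < δ, Attains Φ x i a T c.1 c.2) ∧
      (∀ c ∈ S, ∀ j, (f j c.1, (1 : ℝ)) ∈ c.2) ∧
      ∀ (v : E → E) (r : ℝ), (∀ c ∈ S, DifferentiableAt ℝ v c.1) →
        (∀ c ∈ S, (v c.1, r) ∈ c.2) →
        ∀ c ∈ S, ∀ j, (VectorField.lieBracket ℝ (f j) v c.1, (0 : ℝ)) ∈ c.2 := by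
  have hε : 0 < ε := hδ.trans_le hδε
  let R : Set ℕ := {d | ∃ a, ∃ T < δ, ∃ y V, Attains Φ x i a T y V ∧ Module.finrank ℝ V = d}
  have hRne : R.Nonempty := by
    obtain ⟨V, hV⟩ := Attains.start hΦ hε x i
    exact ⟨_, i, 0, hδ, x, V, hV, rfl⟩
  have hRbdd : BddAbove R := by
    refine ⟨Module.finrank ℝ (E × ℝ), ?_⟩
    rintro _ ⟨a, T, -, y, V, -, rfl⟩
    exact Submodule.finrank_le V
  have hmax := Nat.sSup_mem hRne hRbdd
  set d := sSup R with hd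
  have hle : ∀ {a T y V}, T < δ → Attains Φ x i a T y V → Module.finrank ℝ V ≤ d :=
    fun hT h => le_csSup hRbdd ⟨_, _, hT, _, _, h, rfl⟩
  -- The differential of a flow is injective, so the transported space still has the maximal
  -- dimension `d`; the new space of directions, which contains it, cannot be larger.
  have hstep : ∀ {a T y V}, Attains Φ x i a T y V → Module.finrank ℝ V = d → ∀ j τ, 0 ≤ τ →
      T + τ < δ →
      Attains Φ x i j (T + τ) (Φ j τ y)
        (V.map ((fderiv ℝ (Φ j τ) y).prodMap (.id ℝ ℝ)).toLinearMap) ∧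
      (f j (Φ j τ y), (1 : ℝ)) ∈ V.map ((fderiv ℝ (Φ j τ) y).prodMap (.id ℝ ℝ)).toLinearMap ∧
      Module.finrank ℝ (V.map ((fderiv ℝ (Φ j τ) y).prodMap (.id ℝ ℝ)).toLinearMap) = d := by
    intro a T y V h hV j τ hτ0 hτ
    have hτε : τ < ε := by linarith [h.time_nonneg]
    obtain ⟨V', h', hV', hmem⟩ := h.step hΦ hε j hτ0 hτε
    have hinj : Function.Injective ((fderiv ℝ (Φ j τ) y).prodMap (.id ℝ ℝ)).toLinearMap := by
      have hleft : Function.LeftInverse (fderiv ℝ (Φ j (-τ)) (Φ j τ y)) (fderiv ℝ (Φ j τ) y) :=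
        fun u => DFunLike.congr_fun
          ((hΦ j).fderiv_neg_comp_fderiv (hf j) ⟨by linarith, hτε⟩ y) u
      exact hleft.injective.prodMap Function.injective_id
    have hfin : Module.finrank ℝ
        (V.map ((fderiv ℝ (Φ j τ) y).prodMap (.id ℝ ℝ)).toLinearMap) = d := by
      rw [← hV]
      exact (Submodule.equivMapOfInjective _ hinj V).finrank_eq.symm
    have heq := Submodule.eq_of_le_of_finrank_le hV' (by rw [hfin]; exact hle hτ h')
    rw [heq]
    rw [heq] at hfin
    exact ⟨h', hmem, hfin⟩
  refine ⟨{c | ∃ a, ∃ T < δ, Attains Φ x i a T c.1 c.2 ∧ Module.finrank ℝ c.2 = d}, ?_, ?_, ?_, ?_⟩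
  · obtain ⟨a, T, hT, y, V, h, hV⟩ := hmax
    exact ⟨(y, V), a, T, hT, h, hV⟩
  · rintro c ⟨a, T, hT, h, -⟩
    exact ⟨a, T, hT, h⟩
  · rintro ⟨y, V⟩ ⟨a, T, hT, h, hV⟩ j
    have h1 := (hstep h hV j 0 le_rfl (by simpa using hT)).2.1
    have hid : Φ j 0 = id := funext (hΦ j).zero
    rw [hid, fderiv_id] at h1
    simpa using h1
  · rintro v r hv hmem ⟨y, V⟩ ⟨a, T, hT, h, hV⟩ j
    have hyS := hv (y, V) ⟨a, T, hT, h, hV⟩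
    have hder := ((hΦ j).hasDerivAt_pullback hε hyS).prodMk (hasDerivAt_const (0 : ℝ) r)
    have hclosed : IsClosed (V : Set (E × ℝ)) := V.closed_of_finiteDimensional
    -- The configuration reached after flow `j` for time `s` is again maximal, and its space is the
    -- transport of `V`; so the pullback of `(v, r)` from there lies in `V`.
    have hW : ∀ s ∈ Ico 0 (δ - T),
        (fderiv ℝ (Φ j (-s)) (Φ j s y) (v (Φ j s y)), r) ∈ V := by
      intro s hs
      obtain ⟨h1, -, h3⟩ := hstep h hV j s hs.1 (by linarith [hs.2])
      obtain ⟨p, hp, hpe⟩ := hmem (_, _) ⟨j, T + s, by linarith [hs.2], h1, h3⟩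
      have hsε : s ∈ Ioo (-ε) ε := ⟨by linarith [hs.1], by linarith [hs.2, h.time_nonneg]⟩
      have hp1 : fderiv ℝ (Φ j s) y p.1 = v (Φ j s y) := congrArg Prod.fst hpe
      have hp2 : p.2 = r := congrArg Prod.snd hpe
      have h4 := DFunLike.congr_fun ((hΦ j).fderiv_neg_comp_fderiv (hf j) hsε y) p.1
      rw [ContinuousLinearMap.comp_apply, hp1] at h4
      rw [h4, ← hp2]
      exact hp
    have hW0 := hW 0 ⟨le_rfl, by linarith⟩
    -- The right derivative at `0` is a limit of difference quotients in the closed subspace `V`.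
    -- The constant time component `r` contributes `0`.
    have hlim := (hasDerivWithinAt_iff_tendsto_slope' (s := Ioi (0 : ℝ)) (by simp)).1
      hder.hasDerivWithinAt
    refine hclosed.mem_of_tendsto hlim ?_
    filter_upwards [Ioo_mem_nhdsGT (show (0 : ℝ) < δ - T by linarith)] with s hs
    exact V.smul_mem _ (V.sub_mem (hW s ⟨hs.1.le, hs.2⟩) hW0)

end Accessibility

/-! ### Lie algebras generated by iterated brackets -/

section LieAlgebra

open Set VectorField

variable {n : ℕ} {M : Type*} [TopologicalSpace M] [ChartedSpace (EuclideanSpace ℝ (Fin n)) M]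

lemma involutive_lieClosure (D : Set (∀ x : M, TangentSpace (𝓡 n) x)) :
    Involutive (lieClosure D) := by
  intro v hv w hw
  simp only [lieClosure, Submodule.mem_sInf, mem_ofPred] at hv hw ⊢
  exact fun F hF => hF.2 v (hv F hF) w (hw F hF)

lemma lieClosure_le {D : Set (∀ x : M, TangentSpace (𝓡 n) x)}
    {F : Submodule ℝ (∀ x : M, TangentSpace (𝓡 n) x)} (h : D ⊆ F) (hF : Involutive F) :
    lieClosure D ≤ F :=
  sInf_le ⟨h, hF⟩

variable [IsManifold (𝓡 n) ∞ M]

lemma minSmoothness_le_infty (m : ℕ) : minSmoothness ℝ (m : WithTop ℕ∞) ≤ ∞ := by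
  rw [minSmoothness_of_isRCLikeNormedField]
  exact WithTop.coe_le_coe.2 le_top

lemma infty_add_one : (∞ : WithTop ℕ∞) + 1 = ∞ := by norm_cast

/-- The space of smooth vector fields. -/
def smoothFields (n : ℕ) (M : Type*) [TopologicalSpace M]
    [ChartedSpace (EuclideanSpace ℝ (Fin n)) M] [IsManifold (𝓡 n) ∞ M] :
    Submodule ℝ (∀ x : M, TangentSpace (𝓡 n) x) where
  carrier := {v | ContMDiff (𝓡 n) (𝓡 n).tangent ∞
    fun x => (⟨x, v x⟩ : TangentBundle (𝓡 n) M)}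
  zero_mem' := Bundle.contMDiff_zeroSection ℝ (TangentSpace (𝓡 n) : M → Type _)
  add_mem' hv hw := ContMDiff.add_section hv hw
  smul_mem' _ _ hv := ContMDiff.const_smul_section hv

lemma mem_smoothFields {v : ∀ x : M, TangentSpace (𝓡 n) x} :
    v ∈ smoothFields n M ↔ ContMDiff (𝓡 n) (𝓡 n).tangent ∞
      fun x => (⟨x, v x⟩ : TangentBundle (𝓡 n) M) := Iff.rfl

lemma mdifferentiableAt_of_mem_smoothFields {v : ∀ x : M, TangentSpace (𝓡 n) x}
    (hv : v ∈ smoothFields n M) (x : M) :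
    MDifferentiableAt (𝓡 n) (𝓡 n).tangent
      (fun x => (⟨x, v x⟩ : TangentBundle (𝓡 n) M)) x :=
  (mem_smoothFields.1 hv).mdifferentiable (by simp) x

lemma involutive_smoothFields : Involutive (smoothFields n M) := by
  intro v hv w hw x
  have : IsManifold (𝓡 n) (((⊤ : ℕ∞) : WithTop ℕ∞) + 1) M := by
    rw [infty_add_one]
    infer_instance
  have : IsManifold (𝓡 n) (minSmoothness ℝ 2) M := IsManifold.of_le (minSmoothness_le_infty 2)
  exact ContMDiffAt.mlieBracket_vectorField (n := ⊤) (m := ⊤) (hv x) (hw x)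
    (by rw [minSmoothness_of_isRCLikeNormedField, infty_add_one])

lemma mlieBracket_jacobi {u v w : ∀ x : M, TangentSpace (𝓡 n) x} (hu : u ∈ smoothFields n M)
    (hv : v ∈ smoothFields n M) (hw : w ∈ smoothFields n M) :
    mlieBracket (𝓡 n) (mlieBracket (𝓡 n) u v) w = mlieBracket (𝓡 n) u (mlieBracket (𝓡 n) v w) -
      mlieBracket (𝓡 n) v (mlieBracket (𝓡 n) u w) := by
  have h2 : minSmoothness ℝ 2 ≤ (∞ : WithTop ℕ∞) := minSmoothness_le_infty 2
  have : IsManifold (𝓡 n) (minSmoothness ℝ 3) M := IsManifold.of_le (minSmoothness_le_infty 3)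
  rw [leibniz_identity_mlieBracket (ContMDiff.of_le hu h2) (ContMDiff.of_le hv h2)
    (ContMDiff.of_le hw h2), add_sub_cancel_right]

/-- If a space `F` of vector fields contains the smooth vector fields `u i` and the brackets
`[u i, v]` with smooth members `v` of `F` belong to `F₀ ≤ F`, then `F` contains the Lie algebra
generated by the `u i`, and `F₀` its derived algebra. -/
theorem lieClosure_le_and_derivedAlgebra_le {ι : Type*} {u : ι → ∀ x : M, TangentSpace (𝓡 n) x}
    (hu : ∀ i, u i ∈ smoothFields n M) {F F₀ : Submodule ℝ (∀ x : M, TangentSpace (𝓡 n) x)}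
    (hF₀ : F₀ ≤ F) (huF : ∀ i, u i ∈ F)
    (had : ∀ v ∈ F, v ∈ smoothFields n M → ∀ i, mlieBracket (𝓡 n) (u i) v ∈ F₀) :
    lieClosure (range u) ≤ F ∧ derivedAlgebra (range u) ≤ F₀ := by
  have : IsManifold (𝓡 n) 2 M := IsManifold.of_le (n := ∞) (WithTop.coe_le_coe.2 le_top)
  -- `G` is the smallest space that contains the `u i` and is stable under bracketing with each `u
  -- i`. Only such brackets are controlled by `had`; it must be shown that `G` is already a Lie
  -- algebra.
  let C : Set (Submodule ℝ (∀ x : M, TangentSpace (𝓡 n) x)) :=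
    {H | range u ⊆ H ∧ ∀ i, ∀ v ∈ H, mlieBracket (𝓡 n) (u i) v ∈ H}
  set G := sInf C with hG
  have hGle : ∀ H ∈ C, G ≤ H := fun H hH => sInf_le hH
  have huG : ∀ i, u i ∈ G := fun i => by
    rw [hG, Submodule.mem_sInf]
    exact fun H hH => hH.1 (mem_range_self i)
  have hGad : ∀ i, ∀ v ∈ G, mlieBracket (𝓡 n) (u i) v ∈ G := fun i v hv => by
    rw [hG, Submodule.mem_sInf] at hv ⊢
    exact fun H hH => hH.2 i v (hv H hH)
  have hGs : G ≤ smoothFields n M :=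
    hGle _ ⟨range_subset_iff.2 hu, fun i v hv => involutive_smoothFields _ (hu i) _ hv⟩
  have hGF : G ≤ F := (hGle (F ⊓ smoothFields n M) ⟨range_subset_iff.2 fun i => ⟨huF i, hu i⟩,
    fun i v hv => ⟨hF₀ (had v hv.1 hv.2 i), involutive_smoothFields _ (hu i) _ hv.2⟩⟩).trans
    inf_le_left
  have hGad₀ : ∀ i, ∀ v ∈ G, mlieBracket (𝓡 n) (u i) v ∈ G ⊓ F₀ :=
    fun i v hv => ⟨hGad i v hv, had v (hGF hv) (hGs hv) i⟩
  -- `N` consists of the smooth fields whose brackets with `G` fall into `G ⊓ F₀`. It contains the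
  -- `u i` and, by the Jacobi identity, is stable under their brackets, so `G ≤ N`.
  let N : Submodule ℝ (∀ x : M, TangentSpace (𝓡 n) x) :=
    { carrier := {w | w ∈ smoothFields n M ∧ ∀ v ∈ G, mlieBracket (𝓡 n) w v ∈ G ⊓ F₀}
      zero_mem' := ⟨zero_mem _, fun v _ => by
        rw [mlieBracket_zero_left]
        exact zero_mem _⟩
      add_mem' := by
        rintro a b ⟨ha, ha'⟩ ⟨hb, hb'⟩
        refine ⟨add_mem ha hb, fun v hv => ?_⟩
        have h1 : mlieBracket (𝓡 n) (a + b) v =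
            mlieBracket (𝓡 n) a v + mlieBracket (𝓡 n) b v := by
          funext x
          exact mlieBracket_add_left (mdifferentiableAt_of_mem_smoothFields ha x)
            (mdifferentiableAt_of_mem_smoothFields hb x)
        rw [h1]
        exact add_mem (ha' v hv) (hb' v hv)
      smul_mem' := by
        rintro c a ⟨ha, ha'⟩
        refine ⟨Submodule.smul_mem _ c ha, fun v hv => ?_⟩
        have h1 : mlieBracket (𝓡 n) (c • a) v = c • mlieBracket (𝓡 n) a v := by
          funext x
          exact mlieBracket_const_smul_left (mdifferentiableAt_of_mem_smoothFields ha x)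
        rw [h1]
        exact Submodule.smul_mem _ c (ha' v hv) }
  have hGN : G ≤ N := by
    refine hGle N ⟨range_subset_iff.2 fun i => ⟨hu i, hGad₀ i⟩, ?_⟩
    rintro i w ⟨hw, hw'⟩
    refine ⟨involutive_smoothFields _ (hu i) _ hw, fun v hv => ?_⟩
    rw [mlieBracket_jacobi (hu i) hw (hGs hv)]
    exact sub_mem (hGad₀ i _ (hw' v hv).1) (hw' _ (hGad i v hv))
  have hclos : lieClosure (range u) ≤ G :=
    lieClosure_le (range_subset_iff.2 huG) fun v hv w hw => ((hGN hv).2 w hw).1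
  refine ⟨hclos.trans hGF, ?_⟩
  set B : Set (∀ x : M, TangentSpace (𝓡 n) x) :=
    {b | ∃ v ∈ lieClosure (range u), ∃ w ∈ lieClosure (range u),
      b = mlieBracket (𝓡 n) v w} with hB
  have hBc : Submodule.span ℝ B ≤ lieClosure (range u) := by
    rw [Submodule.span_le]
    rintro _ ⟨v, hv, w, hw, rfl⟩
    exact involutive_lieClosure _ v hv w hw
  have hB₀ : Submodule.span ℝ B ≤ F₀ := by
    rw [Submodule.span_le]
    rintro _ ⟨v, hv, w, hw, rfl⟩
    exact ((hGN (hclos hv)).2 w (hclos hw)).2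
  -- The span of the brackets is itself closed under brackets, since its members belong to the Lie
  -- algebra; no further closure is needed.
  refine le_trans (lieClosure_le Submodule.subset_span fun v hv w hw => ?_) hB₀
  exact Submodule.subset_span ⟨v, hBc hv, w, hBc hw, rfl⟩

end LieAlgebra

/-! ### Vector fields and flows in a chart -/

section Chart

open Set VectorField Topology

variable {n : ℕ} {M : Type*} [TopologicalSpace M] [ChartedSpace (EuclideanSpace ℝ (Fin n)) M]

lemma mlieBracket_eq_lieBracket {E : Type*} [NormedAddCommGroup E] [NormedSpace ℝ E]
    (v w : ∀ x : E, TangentSpace 𝓘(ℝ, E) x) :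
    mlieBracket 𝓘(ℝ, E) v w = lieBracket ℝ v w := by
  rw [← mlieBracketWithin_univ, mlieBracketWithin_eq_lieBracketWithin]
  exact lieBracketWithin_univ

/-- The vector field `v` in the coordinates of the chart at `ξ`. -/
noncomputable def chartField (ξ : M) (v : ∀ x : M, TangentSpace (𝓡 n) x) :
    EuclideanSpace ℝ (Fin n) → EuclideanSpace ℝ (Fin n) :=
  mpullback 𝓘(ℝ, EuclideanSpace ℝ (Fin n)) (𝓡 n) (extChartAt (𝓡 n) ξ).symm v

lemma chartField_add (ξ : M) (v w : ∀ x : M, TangentSpace (𝓡 n) x)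
    (y : EuclideanSpace ℝ (Fin n)) :
    chartField ξ (v + w) y = chartField ξ v y + chartField ξ w y :=
  mpullback_add_apply

lemma chartField_smul (ξ : M) (c : ℝ) (v : ∀ x : M, TangentSpace (𝓡 n) x)
    (y : EuclideanSpace ℝ (Fin n)) :
    chartField ξ (c • v) y = c • chartField ξ v y :=
  mpullback_const_smul_apply

lemma chartField_zero (ξ : M) (y : EuclideanSpace ℝ (Fin n)) :
    chartField ξ (0 : ∀ x : M, TangentSpace (𝓡 n) x) y = 0 := by
  simpa using chartField_smul ξ 0 0 y

variable [IsManifold (𝓡 n) ∞ M] {ξ : M} {y : EuclideanSpace ℝ (Fin n)}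

lemma contMDiffAt_extChartAt_symm (hy : y ∈ (extChartAt (𝓡 n) ξ).target) :
    ContMDiffAt 𝓘(ℝ, EuclideanSpace ℝ (Fin n)) (𝓡 n) ∞ (extChartAt (𝓡 n) ξ).symm y :=
  (contMDiffOn_extChartAt_symm ξ).contMDiffAt ((isOpen_extChartAt_target ξ).mem_nhds hy)

lemma isInvertible_mfderiv_extChartAt_symm (hy : y ∈ (extChartAt (𝓡 n) ξ).target) :
    (mfderiv 𝓘(ℝ, EuclideanSpace ℝ (Fin n)) (𝓡 n) (extChartAt (𝓡 n) ξ).symm y).IsInvertible := by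
  have : IsManifold (𝓡 n) 1 M := IsManifold.of_le (n := ∞) (WithTop.coe_le_coe.2 le_top)
  have h := isInvertible_mfderivWithin_extChartAt_symm (I := 𝓡 n) hy
  rwa [ModelWithCorners.range_eq_univ, mfderivWithin_univ] at h

lemma mfderiv_chartField (v : ∀ x : M, TangentSpace (𝓡 n) x)
    (hy : y ∈ (extChartAt (𝓡 n) ξ).target) :
    mfderiv 𝓘(ℝ, EuclideanSpace ℝ (Fin n)) (𝓡 n) (extChartAt (𝓡 n) ξ).symm y (chartField ξ v y) =
      v ((extChartAt (𝓡 n) ξ).symm y) :=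
  (isInvertible_mfderiv_extChartAt_symm hy).self_apply_inverse _

lemma contDiffAt_chartField {v : ∀ x : M, TangentSpace (𝓡 n) x} (hv : v ∈ smoothFields n M)
    (hy : y ∈ (extChartAt (𝓡 n) ξ).target) : ContDiffAt ℝ ∞ (chartField ξ v) y := by
  have : IsManifold (𝓡 n) 1 M := IsManifold.of_le (n := ∞) (WithTop.coe_le_coe.2 le_top)
  exact contMDiffAt_vectorSpace_iff_contDiffAt.1
    (ContMDiffAt.mpullback_vectorField_preimage (mem_smoothFields.1 hv _)
      (contMDiffAt_extChartAt_symm hy) (isInvertible_mfderiv_extChartAt_symm hy)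
      infty_add_one.le)

lemma chartField_mlieBracket {v w : ∀ x : M, TangentSpace (𝓡 n) x} (hv : v ∈ smoothFields n M)
    (hw : w ∈ smoothFields n M) (hy : y ∈ (extChartAt (𝓡 n) ξ).target) :
    chartField ξ (mlieBracket (𝓡 n) v w) y =
      lieBracket ℝ (chartField ξ v) (chartField ξ w) y := by
  have : IsManifold (𝓡 n) (minSmoothness ℝ 3) M := IsManifold.of_le (minSmoothness_le_infty 3)
  have h := mpullback_mlieBracket (mdifferentiableAt_of_mem_smoothFields hv _)
    (mdifferentiableAt_of_mem_smoothFields hw _) (contMDiffAt_extChartAt_symm hy) (minSmoothness_le_infty 2)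
  exact h.trans (congrFun (mlieBracket_eq_lieBracket (chartField ξ v) (chartField ξ w)) y)

/-- In a chart a smooth vector field agrees near a given point with a field of compact support. -/
lemma exists_cutoff_chartField (ξ : M) {v : ∀ x : M, TangentSpace (𝓡 n) x}
    (hv : v ∈ smoothFields n M) {r : ℝ} (hr : 0 < r)
    (hball : Metric.closedBall (extChartAt (𝓡 n) ξ ξ) (2 * r) ⊆ (extChartAt (𝓡 n) ξ).target) :
    ∃ f : EuclideanSpace ℝ (Fin n) → EuclideanSpace ℝ (Fin n), ContDiff ℝ 2 f ∧
      HasCompactSupport f ∧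
      ∀ y ∈ Metric.ball (extChartAt (𝓡 n) ξ ξ) r, f y = chartField ξ v y := by
  let χ : ContDiffBump (extChartAt (𝓡 n) ξ ξ) := ⟨r, 2 * r, hr, by linarith⟩
  have hsupp : HasCompactSupport fun y => χ y • chartField ξ v y := χ.hasCompactSupport.smul_right
  have hle : (2 : WithTop ℕ∞) ≤ ∞ := WithTop.coe_le_coe.2 le_top
  refine ⟨fun y => χ y • chartField ξ v y, contDiff_iff_contDiffAt.2 fun y => ?_, hsupp,
    fun y hy => ?_⟩
  · by_cases hy : y ∈ tsupport χ
    · rw [χ.tsupport_eq] at hy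
      exact χ.contDiff.contDiffAt.smul ((contDiffAt_chartField hv (hball hy)).of_le hle)
    · have h0 : (fun y => χ y • chartField ξ v y) =ᶠ[𝓝 y] fun _ => 0 := by
        filter_upwards [notMem_tsupport_iff_eventuallyEq.1 hy] with z hz
        rw [hz, Pi.zero_apply, zero_smul]
      exact contDiffAt_const.congr_of_eventuallyEq h0
  · simp only [χ.one_of_mem_closedBall (Metric.ball_subset_closedBall hy), one_smul]

/-- The flows of finitely many smooth vector fields in the chart at `ξ`, near the point `ξ` and
for small times. -/
lemma exists_localFlow_chartField {ι : Type*} [Finite ι] (ξ : M)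
    {u : ι → ∀ x : M, TangentSpace (𝓡 n) x} (hu : ∀ j, u j ∈ smoothFields n M) :
    ∃ r > 0, Metric.ball (extChartAt (𝓡 n) ξ ξ) r ⊆ (extChartAt (𝓡 n) ξ).target ∧
      ∃ (f : ι → EuclideanSpace ℝ (Fin n) → EuclideanSpace ℝ (Fin n)) (K : ι → NNReal) (C : ℝ)
        (ε : ℝ) (Φ : ι → ℝ → EuclideanSpace ℝ (Fin n) → EuclideanSpace ℝ (Fin n)),
        0 < ε ∧ 0 < C ∧ (∀ j, LipschitzWith (K j) (f j)) ∧ (∀ j x, ‖f j x‖ ≤ C) ∧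
        (∀ j, IsLocalFlow (f j) ε (Φ j)) ∧
        ∀ j, ∀ y ∈ Metric.ball (extChartAt (𝓡 n) ξ ξ) r, f j y = chartField ξ (u j) y := by
  have := Fintype.ofFinite ι
  obtain ⟨R, hR, hball⟩ := Metric.nhds_basis_closedBall.mem_iff.1
    (extChartAt_target_mem_nhds (I := 𝓡 n) ξ)
  have hball' : Metric.closedBall (extChartAt (𝓡 n) ξ ξ) (2 * (R / 2)) ⊆
      (extChartAt (𝓡 n) ξ).target := by
    rwa [mul_div_cancel₀ R two_ne_zero]
  choose f hf2 hfs hfv using fun j => exists_cutoff_chartField ξ (hu j) (half_pos hR) hball'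
  choose K hK using fun j => (hf2 j).lipschitzWith_of_hasCompactSupport (hfs j) (by simp)
  choose C hC using fun j => (hfs j).exists_bound_of_continuous (hf2 j).continuous
  choose ε hε Φ hΦ using fun j => exists_isLocalFlow (hf2 j) (hK j)
  obtain ⟨ε₀, hε₀, hε₀'⟩ : ∃ ε₀ > 0, ∀ j, ε₀ ≤ ε j := by
    obtain ⟨e, he⟩ := Finite.exists_ge fun j => (⟨ε j, hε j⟩ : {x : ℝ // 0 < x})
    exact ⟨e.1, e.2, he⟩
  obtain ⟨C₀, hC₀⟩ := Finite.exists_le C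
  refine ⟨R / 2, half_pos hR, (Metric.ball_subset_closedBall.trans
    (Metric.closedBall_subset_closedBall (by linarith))).trans hball, f, K, max C₀ 1, ε₀, Φ, hε₀,
    by positivity, hK, fun j x => ((hC j x).trans (hC₀ j)).trans (le_max_left _ _),
    fun j => (hΦ j).mono (hε₀' j), hfv⟩

end Chart

/-! ### Condition A yields full rank in space-time -/

section ConditionA

open Set VectorField Topology

variable {n k : ℕ} {M : Type*} [TopologicalSpace M] [ChartedSpace (EuclideanSpace ℝ (Fin n)) M]
  [IsManifold (𝓡 n) ∞ M] {u : Fin k → ∀ x : M, TangentSpace (𝓡 n) x}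

lemma zeroTimeIdeal_le_smoothFields (hu : ∀ i, u i ∈ smoothFields n M) :
    zeroTimeIdeal u ≤ smoothFields n M := by
  rintro _ ⟨v, hv, c, -, rfl⟩
  have h := (lieClosure_le_and_derivedAlgebra_le hu le_rfl hu
    fun v _ hv i => involutive_smoothFields _ (hu i) _ hv).2
  exact add_mem (h hv) (sum_mem fun i _ => Submodule.smul_mem _ _ (hu i))

/-- Condition A at a point persists near the point. -/
lemma eventually_span_zeroTimeIdeal (hu : ∀ i, u i ∈ smoothFields n M) {ξ : M}
    (hA : ConditionA u ξ) :
    ∀ᶠ y in 𝓝 (extChartAt (𝓡 n) ξ ξ),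
      Submodule.span ℝ ((fun w => chartField ξ w y) '' (zeroTimeIdeal u : Set _)) = ⊤ := by
  set x₀ := extChartAt (𝓡 n) ξ ξ with hx₀
  have hx₀t : x₀ ∈ (extChartAt (𝓡 n) ξ).target := mem_extChartAt_target ξ
  have hfin : Module.finrank ℝ (TangentSpace (𝓡 n) ξ) = n := finrank_euclideanSpace_fin
  have : FiniteDimensional ℝ (TangentSpace (𝓡 n) ξ) :=
    inferInstanceAs (FiniteDimensional ℝ (EuclideanSpace ℝ (Fin n)))
  have htop : zeroTimeIdealAt u ξ = ⊤ :=
    Submodule.eq_top_of_finrank_eq (hA.trans hfin.symm)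
  have hex : ∀ e : EuclideanSpace ℝ (Fin n), ∃ w ∈ zeroTimeIdeal u, chartField ξ w x₀ = e := by
    intro e
    set D := mfderiv 𝓘(ℝ, EuclideanSpace ℝ (Fin n)) (𝓡 n) (extChartAt (𝓡 n) ξ).symm x₀ with hD
    have hξ : (extChartAt (𝓡 n) ξ).symm x₀ = ξ := extChartAt_to_inv ξ
    have hDe : ∃ w ∈ zeroTimeIdeal u, w ((extChartAt (𝓡 n) ξ).symm x₀) = D e := by
      -- The tangent space depends on the base point, so the equality of points is eliminated before
      -- vectors are compared.
      have key : ∀ η : M, ξ = η → ∀ z : TangentSpace (𝓡 n) η, ∃ w ∈ zeroTimeIdeal u, w η = z := by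
        rintro η rfl z
        have hz : z ∈ zeroTimeIdealAt u ξ := by
          rw [htop]
          exact Submodule.mem_top
        exact hz
      exact key _ hξ.symm (D e)
    obtain ⟨w, hw, hwe⟩ := hDe
    refine ⟨w, hw, ?_⟩
    change D.inverse (w ((extChartAt (𝓡 n) ξ).symm x₀)) = e
    rw [hwe]
    exact (isInvertible_mfderiv_extChartAt_symm hx₀t).inverse_apply_self e
  -- Members of the ideal representing the standard basis at `x₀` remain linearly independent at
  -- nearby points.
  choose w hw hwe using fun l : Fin n => hex (EuclideanSpace.basisFun (Fin n) ℝ l)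
  have hcont : ContinuousAt (fun y => fun l => chartField ξ (w l) y) x₀ :=
    continuousAt_pi.2 fun l =>
      (contDiffAt_chartField (zeroTimeIdeal_le_smoothFields hu (hw l)) hx₀t).continuousAt
  have hli : LinearIndependent ℝ fun l => chartField ξ (w l) x₀ := by
    simp only [hwe]
    exact (EuclideanSpace.basisFun (Fin n) ℝ).orthonormal.linearIndependent
  filter_upwards [hcont.preimage_mem_nhds (isOpen_setOfPred_linearIndependent.mem_nhds hli)] with y hy
  have h1 := LinearIndependent.span_eq_top_of_card_eq_finrank' (b := fun l => chartField ξ (w l) y)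
    hy (by simp)
  rw [eq_top_iff, ← h1]
  exact Submodule.span_mono (range_subset_iff.2 fun l => mem_image_of_mem _ (hw l))

/-- Under Condition A, in arbitrarily short time configurations are attained at which the endpoint
and the elapsed time vary in all directions of space-time. -/
theorem exists_attains_top (hu : ∀ i, u i ∈ smoothFields n M) {ξ : M} (hA : ConditionA u ξ)
    [Nontrivial (Fin k)] {r : ℝ} (hr : 0 < r)
    (hball : Metric.ball (extChartAt (𝓡 n) ξ ξ) r ⊆ (extChartAt (𝓡 n) ξ).target)
    {f : Fin k → EuclideanSpace ℝ (Fin n) → EuclideanSpace ℝ (Fin n)} {K : Fin k → NNReal}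
    {C ε : ℝ} {Φ : Fin k → ℝ → EuclideanSpace ℝ (Fin n) → EuclideanSpace ℝ (Fin n)}
    (hε : 0 < ε) (hC : 0 < C) (hfK : ∀ j, LipschitzWith (K j) (f j)) (hfC : ∀ j x, ‖f j x‖ ≤ C)
    (hΦ : ∀ j, IsLocalFlow (f j) ε (Φ j))
    (hf : ∀ j, ∀ y ∈ Metric.ball (extChartAt (𝓡 n) ξ ξ) r, f j y = chartField ξ (u j) y)
    (i : Fin k) {δ : ℝ} (hδ : 0 < δ) :
    ∃ a, ∃ T < δ, ∃ y, Attains Φ (extChartAt (𝓡 n) ξ ξ) i a T y ⊤ := by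
  set x₀ := extChartAt (𝓡 n) ξ ξ with hx₀
  obtain ⟨ρ, hρ, hspan⟩ := Metric.eventually_nhds_iff_ball.1 (eventually_span_zeroTimeIdeal hu hA)
  -- The speed is at most `C`: times below `r / C` keep the points where `f j` represents `u j`, and
  -- times below `ρ / C` keep them where the ideal spans.
  set δ' := min δ (min ε (min (r / C) (ρ / C))) with hδ'
  have hδ'pos : 0 < δ' := by positivity
  obtain ⟨S, ⟨c₀, hc₀⟩, hS, hSf, hSb⟩ := exists_maximal_configurations hΦ hfK hδ'pos
    ((min_le_right _ _).trans (min_le_left _ _)) x₀ i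
  have hdist : ∀ c ∈ S, dist c.1 x₀ < r ∧ dist c.1 x₀ < ρ := by
    intro c hc
    obtain ⟨a, T, hT, h⟩ := hS c hc
    simp only [hδ', lt_min_iff, lt_div_iff₀ hC] at hT
    have h1 := h.dist_le hΦ hfC hT.2.1
    rw [mul_comm] at h1
    exact ⟨by linarith [hT.2.2.1], by linarith [hT.2.2.2]⟩
  -- `F₀` collects the fields that are directions with time component `0`, `F` those with some
  -- constant time component. A bracket with `u j` leads from smooth members of `F` to `F₀`.
  let F₀ : Submodule ℝ (∀ x : M, TangentSpace (𝓡 n) x) :=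
    { carrier := {v | ∀ c ∈ S, (chartField ξ v c.1, (0 : ℝ)) ∈ c.2}
      zero_mem' := fun c _ => by
        rw [chartField_zero]
        exact zero_mem c.2
      add_mem' := fun {v w} hv hw c hc => by
        rw [chartField_add]
        simpa using add_mem (hv c hc) (hw c hc)
      smul_mem' := fun b v hv c hc => by
        rw [chartField_smul]
        simpa using c.2.smul_mem b (hv c hc) }
  let F : Submodule ℝ (∀ x : M, TangentSpace (𝓡 n) x) :=
    { carrier := {v | ∃ τ : ℝ, ∀ c ∈ S, (chartField ξ v c.1, τ) ∈ c.2}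
      zero_mem' := ⟨0, fun c _ => by
        rw [chartField_zero]
        exact zero_mem c.2⟩
      add_mem' := by
        rintro v w ⟨τ, hv⟩ ⟨τ', hw⟩
        refine ⟨τ + τ', fun c hc => ?_⟩
        rw [chartField_add]
        exact add_mem (hv c hc) (hw c hc)
      smul_mem' := by
        rintro b v ⟨τ, hv⟩
        refine ⟨b • τ, fun c hc => ?_⟩
        rw [chartField_smul]
        exact c.2.smul_mem b (hv c hc) }
  have huF : ∀ j, ∀ c ∈ S, (chartField ξ (u j) c.1, (1 : ℝ)) ∈ c.2 := fun j c hc => by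
    rw [← hf j c.1 (Metric.mem_ball.2 (hdist c hc).1)]
    exact hSf c hc j
  have had : ∀ v ∈ F, v ∈ smoothFields n M → ∀ j, mlieBracket (𝓡 n) (u j) v ∈ F₀ := by
    rintro v ⟨τ, hv⟩ hvs j c hc
    have hct : c.1 ∈ Metric.ball x₀ r := Metric.mem_ball.2 (hdist c hc).1
    rw [chartField_mlieBracket (hu j) hvs (hball hct)]
    have h1 : chartField ξ (u j) =ᶠ[𝓝 c.1] f j := by
      filter_upwards [Metric.isOpen_ball.mem_nhds hct] with y hy
      exact (hf j y hy).symm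
    rw [h1.lieBracket_vectorField_eq (Filter.EventuallyEq.refl _ _)]
    refine hSb _ τ (fun c hc => ?_) hv c hc j
    exact (contDiffAt_chartField hvs
      (hball (Metric.mem_ball.2 (hdist c hc).1))).differentiableAt (by simp)
  have hder := (lieClosure_le_and_derivedAlgebra_le hu (F := F) (F₀ := F₀)
    (fun v hv => ⟨0, hv⟩) (fun j => ⟨1, huF j⟩) had).2
  have hzero : zeroTimeIdeal u ≤ F₀ := by
    rintro _ ⟨v, hv, b, hb, rfl⟩
    refine add_mem (hder hv) fun c hc => ?_
    -- The time component of this combination is `∑ b j = 0`.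
    have h1 : ∑ j, b j • (chartField ξ (u j) c.1, (1 : ℝ)) ∈ c.2 :=
      sum_mem fun j _ => c.2.smul_mem _ (huF j c hc)
    have h2 : chartField ξ (∑ j, b j • u j) c.1 = ∑ j, b j • chartField ξ (u j) c.1 := by
      let A : (∀ x : M, TangentSpace (𝓡 n) x) →ₗ[ℝ] EuclideanSpace ℝ (Fin n) :=
        { toFun := fun v => chartField ξ v c.1
          map_add' := fun v w => chartField_add ξ v w c.1
          map_smul' := fun a v => chartField_smul ξ a v c.1 }
      have h3 := map_sum A (fun j => b j • u j) Finset.univ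
      simp only [map_smul] at h3
      exact h3
    rw [h2]
    convert h1
    ext
    · simp [Prod.fst_sum]
    · simp [Prod.snd_sum, hb]
  obtain ⟨a, T, hT, h⟩ := hS c₀ hc₀
  refine ⟨a, T, hT.trans_le (min_le_left _ _), c₀.1, ?_⟩
  convert h
  symm
  have hE : ∀ e : EuclideanSpace ℝ (Fin n), (e, (0 : ℝ)) ∈ c₀.2 := by
    intro e
    have he : e ∈ Submodule.span ℝ
        ((fun w => chartField ξ w c₀.1) '' (zeroTimeIdeal u : Set _)) := by
      rw [hspan c₀.1 (Metric.mem_ball.2 (hdist c₀ hc₀).2)]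
      exact Submodule.mem_top
    have hle : Submodule.span ℝ ((fun w => chartField ξ w c₀.1) '' (zeroTimeIdeal u : Set _)) ≤
        c₀.2.comap (LinearMap.inl ℝ (EuclideanSpace ℝ (Fin n)) ℝ) := by
      rw [Submodule.span_le]
      rintro _ ⟨w, hw, rfl⟩
      exact hzero hw c₀ hc₀
    exact hle he
  refine eq_top_iff.2 fun p _ => ?_
  have h1 := add_mem (c₀.2.smul_mem p.2 (hSf c₀ hc₀ i)) (hE (p.1 - p.2 • f i c₀.1))
  simpa using h1

end ConditionA

/-! ### Null sets under submersions -/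

section NullPreimage

open Set Filter Topology
open scoped NNReal ENNReal

/-- The preimage of a null set under a surjective linear map is a null set. -/
lemma addHaar_preimage_null_of_surjective {E F : Type*} [NormedAddCommGroup E] [NormedSpace ℝ E]
    [FiniteDimensional ℝ E] [MeasurableSpace E] [BorelSpace E] [NormedAddCommGroup F]
    [NormedSpace ℝ F] [FiniteDimensional ℝ F] [MeasurableSpace F] [BorelSpace F] (μ : Measure E)
    [μ.IsAddHaarMeasure] (ν : Measure F) [ν.IsAddHaarMeasure] {A : E →L[ℝ] F}
    (hA : Function.Surjective A) {N : Set F} (hN : ν N = 0) : μ (A ⁻¹' N) = 0 := by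
  obtain ⟨c, -, hmap⟩ := A.toLinearMap.exists_map_addHaar_eq_smul_addHaar μ ν hA
  have h1 : μ.map A (toMeasurable ν N) = 0 := by
    have h2 : μ.map A = c • ν := hmap
    rw [h2, Measure.smul_apply, measure_toMeasurable, hN, smul_zero]
  rw [Measure.map_apply A.continuous.measurable (measurableSet_toMeasurable ν N)] at h1
  exact measure_mono_null (preimage_mono (subset_toMeasurable ν N)) h1

/-- Near a point at which the strict derivative is surjective, preimages of null sets are null
sets. -/
lemma HasStrictFDerivAt.exists_nhds_null_preimage {E F : Type*} [NormedAddCommGroup E]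
    [NormedSpace ℝ E] [FiniteDimensional ℝ E] [MeasurableSpace E] [BorelSpace E]
    [NormedAddCommGroup F] [NormedSpace ℝ F] [FiniteDimensional ℝ F] [MeasurableSpace F]
    [BorelSpace F] (μ : Measure E) [μ.IsAddHaarMeasure] (ν : Measure F) [ν.IsAddHaarMeasure]
    {f : E → F} {A : E →L[ℝ] F} {a : E} (hf : HasStrictFDerivAt f A a)
    (hA : Function.Surjective A) : ∃ U ∈ 𝓝 a, ∀ N, ν N = 0 → μ (U ∩ f ⁻¹' N) = 0 := by
  obtain ⟨R, hR⟩ := A.exists_rightInverse_of_surjective (LinearMap.range_eq_top.2 hA)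
  have hAR : ∀ y, A (R y) = y := fun y => DFunLike.congr_fun hR y
  -- With a right inverse `R` of `A`, the map `G` has derivative `id` at `a` and satisfies `A ∘ G =
  -- f`. This reduces `f` to the linear map `A`.
  set G : E → E := fun x => x + R (f x - A x) with hG
  have hAG : ∀ x, A (G x) = f x := fun x => by simp [hG, hAR]
  have hGd : HasStrictFDerivAt G (ContinuousLinearMap.id ℝ E) a := by
    have h1 := (hasStrictFDerivAt_id a).add
      (R.hasStrictFDerivAt.comp a (hf.sub A.hasStrictFDerivAt))
    have h2 : ContinuousLinearMap.id ℝ E + R ∘L (A - A) = ContinuousLinearMap.id ℝ E := by simp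
    rw [h2] at h1
    exact h1
  -- A map close to the identity shrinks measures at most by the factor `1 / 2`, so a set with null
  -- image is null.
  have hdet := mul_le_addHaar_image_of_lt_det μ (ContinuousLinearMap.id ℝ E) (m := 1 / 2)
    (by simp [ContinuousLinearMap.det])
  obtain ⟨c, hc, hc0⟩ := (hdet.and self_mem_nhdsWithin).exists
  obtain ⟨U, hU, hUG⟩ := hGd.approximates_deriv_on_nhds (c := c) (Or.inr hc0)
  refine ⟨U, hU, fun N hN => ?_⟩
  have h1 := hc (U ∩ f ⁻¹' N) G (hUG.mono_set inter_subset_left)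
  have h2 : μ (G '' (U ∩ f ⁻¹' N)) = 0 := by
    refine measure_mono_null ?_ (addHaar_preimage_null_of_surjective μ ν hA hN)
    rintro _ ⟨x, hx, rfl⟩
    change A (G x) ∈ N
    rw [hAG]
    exact hx.2
  rw [h2, nonpos_iff_eq_zero, mul_eq_zero] at h1
  exact h1.resolve_left (by simp)

end NullPreimage

/-! ### Null sets of a manifold -/

section ChartNull

open Set Filter Topology

variable {n : ℕ} {M : Type*} [TopologicalSpace M] [ChartedSpace (EuclideanSpace ℝ (Fin n)) M]

/-- A subset of a manifold is a null set if it has Lebesgue measure zero in all charts. -/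
def ChartNull (n : ℕ) {M : Type*} [TopologicalSpace M]
    [ChartedSpace (EuclideanSpace ℝ (Fin n)) M] (N : Set M) : Prop :=
  ∀ ξ : M, volume ((extChartAt (𝓡 n) ξ).target ∩ (extChartAt (𝓡 n) ξ).symm ⁻¹' N) = 0

lemma ChartNull.mono {N N' : Set M} (hN : ChartNull n N) (h : N' ⊆ N) : ChartNull n N' :=
  fun ξ => measure_mono_null (inter_subset_inter_right _ (preimage_mono h)) (hN ξ)

lemma ChartNull.of_locally {N : Set M} (h : ∀ x ∈ N, ∃ U ∈ 𝓝 x, ChartNull n (U ∩ N)) :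
    ChartNull n N := by
  intro ξ
  refine measure_null_of_locally_null _ fun y hy => ?_
  obtain ⟨U, hU, hUN⟩ := h _ hy.2
  refine ⟨((extChartAt (𝓡 n) ξ).target ∩ (extChartAt (𝓡 n) ξ).symm ⁻¹' N) ∩
    (extChartAt (𝓡 n) ξ).symm ⁻¹' U, inter_mem self_mem_nhdsWithin
      (mem_nhdsWithin_of_mem_nhds ((continuousAt_extChartAt_symm'' hy.1).preimage_mem_nhds hU)),
    measure_mono_null ?_ (hUN ξ)⟩
  exact fun z hz => ⟨hz.1.1, hz.2, hz.1.2⟩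

variable [IsManifold (𝓡 n) ∞ M]

/-- A set in the domain of a chart is a null set if it is so in this chart. -/
lemma ChartNull.of_subset_source {ξ : M} {N : Set M} (hN : N ⊆ (extChartAt (𝓡 n) ξ).source)
    (h : volume ((extChartAt (𝓡 n) ξ).target ∩ (extChartAt (𝓡 n) ξ).symm ⁻¹' N) = 0) :
    ChartNull n N := by
  intro η
  have hsm : ContDiffOn ℝ ∞ (extChartAt (𝓡 n) η ∘ (extChartAt (𝓡 n) ξ).symm)
      ((extChartAt (𝓡 n) ξ).symm.trans (extChartAt (𝓡 n) η)).source :=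
    contDiffOn_ext_coord_change (I := 𝓡 n) (n := ∞) η ξ
  have hnull : volume (((extChartAt (𝓡 n) ξ).symm.trans (extChartAt (𝓡 n) η)).source ∩
      (extChartAt (𝓡 n) ξ).symm ⁻¹' N) = 0 :=
    measure_mono_null (inter_subset_inter_left _ (by
      rw [PartialEquiv.trans_source]
      exact inter_subset_left)) h
  -- The change of charts is differentiable, hence maps null sets to null sets.
  refine measure_mono_null ?_ (addHaar_image_eq_zero_of_differentiableOn_of_addHaar_eq_zero volume
    ((hsm.differentiableOn (by simp)).mono inter_subset_left) hnull)
  rintro y ⟨hy, hyN⟩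
  have h1 : (extChartAt (𝓡 n) ξ).symm (extChartAt (𝓡 n) ξ ((extChartAt (𝓡 n) η).symm y)) =
      (extChartAt (𝓡 n) η).symm y := (extChartAt (𝓡 n) ξ).left_inv (hN hyN)
  refine ⟨extChartAt (𝓡 n) ξ ((extChartAt (𝓡 n) η).symm y), ⟨?_, ?_⟩, ?_⟩
  · rw [PartialEquiv.trans_source]
    refine ⟨(extChartAt (𝓡 n) ξ).map_source (hN hyN), ?_⟩
    change (extChartAt (𝓡 n) ξ).symm (extChartAt (𝓡 n) ξ ((extChartAt (𝓡 n) η).symm y)) ∈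
      (extChartAt (𝓡 n) η).source
    rw [h1]
    exact (extChartAt (𝓡 n) η).map_target hy
  · change (extChartAt (𝓡 n) ξ).symm _ ∈ N
    rw [h1]
    exact hyN
  · rw [Function.comp_apply, h1]
    exact (extChartAt (𝓡 n) η).right_inv hy

end ChartNull

/-! ### The forward flow: uniqueness, continuity, null sets -/

section ForwardFlow

open Set Filter Topology

variable {n : ℕ} {M : Type*} [TopologicalSpace M] [ChartedSpace (EuclideanSpace ℝ (Fin n)) M]

lemma exists_forwardFlow_eq {v : ∀ x : M, TangentSpace (𝓡 n) x} (hv : ForwardComplete v) (η : M) :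
    IsMIntegralCurveOn (fun t => forwardFlow v t η) v (Ici 0) ∧ forwardFlow v 0 η = η := by
  have h := hv η
  have h1 : (fun t => forwardFlow v t η) = h.choose := by
    funext t
    simp only [forwardFlow, dif_pos h]
  rw [h1]
  exact ⟨h.choose_spec.2, (congrFun h1 0).trans h.choose_spec.1⟩

/-- `F` is continuous at `z`, and near `z` preimages of null sets are null sets. -/
def NullRegularAt (n : ℕ) {M : Type*} [TopologicalSpace M]
    [ChartedSpace (EuclideanSpace ℝ (Fin n)) M] (F : M → M) (z : M) : Prop :=
  ContinuousAt F z ∧ ∃ U ∈ 𝓝 z, ∀ N, ChartNull n N → ChartNull n (U ∩ F ⁻¹' N)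

lemma NullRegularAt.comp {F G : M → M} {z : M} (hG : NullRegularAt n G (F z))
    (hF : NullRegularAt n F z) : NullRegularAt n (G ∘ F) z := by
  obtain ⟨hGc, V, hV, hGV⟩ := hG
  obtain ⟨hFc, U, hU, hFU⟩ := hF
  refine ⟨hGc.comp hFc, U ∩ F ⁻¹' V, inter_mem hU (hFc.preimage_mem_nhds hV), fun N hN => ?_⟩
  exact (hFU _ (hGV N hN)).mono fun x hx => ⟨hx.1.1, hx.1.2, hx.2⟩

/-- An integral curve on `[0, T)` can be extended to an integral curve on an open interval. -/
lemma IsMIntegralCurveOn.exists_extend_left {v : ∀ x : M, TangentSpace (𝓡 n) x} {γ σ : ℝ → M}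
    {ε T : ℝ} (hγ : IsMIntegralCurveOn γ v (Ico 0 T)) (hσ : IsMIntegralCurveOn σ v (Ioo (-ε) ε))
    (hε : 0 < ε) (h0 : σ 0 = γ 0) :
    IsMIntegralCurveOn (fun t => if t < 0 then σ t else γ t) v (Ioo (-ε) T) := by
  set γ' : ℝ → M := fun t => if t < 0 then σ t else γ t with hγ'
  have hneg : ∀ t ≤ 0, γ' t = σ t := by
    intro t ht
    rcases ht.lt_or_eq with ht | rfl
    · exact if_pos ht
    · simp [hγ', h0]
  have hpos : ∀ t, 0 ≤ t → γ' t = γ t := fun t ht => if_neg ht.not_gt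
  intro t ht
  apply HasMFDerivAt.hasMFDerivWithinAt
  rcases lt_trichotomy t 0 with h | rfl | h
  · have h1 : HasMFDerivAt 𝓘(ℝ, ℝ) (𝓡 n) σ t
        ((1 : ℝ →L[ℝ] ℝ).smulRight (v (σ t))) :=
      (hσ t ⟨ht.1, h.trans hε⟩).hasMFDerivAt (isOpen_Ioo.mem_nhds ⟨ht.1, h.trans hε⟩)
    rw [hneg t h.le]
    refine h1.congr_of_eventuallyEq ?_
    filter_upwards [Iio_mem_nhds h] with s hs
    exact hneg s hs.le
  · have h1 : HasMFDerivWithinAt 𝓘(ℝ, ℝ) (𝓡 n) γ' (Ioc (-ε) 0) 0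
        ((1 : ℝ →L[ℝ] ℝ).smulRight (v (γ' 0))) := by
      rw [hneg 0 le_rfl]
      exact ((hσ 0 ⟨by linarith, hε⟩).mono (fun s hs => ⟨hs.1, by linarith [hs.2]⟩)).congr_mono
        (fun s hs => hneg s hs.2) (hneg 0 le_rfl) subset_rfl
    have h2 : HasMFDerivWithinAt 𝓘(ℝ, ℝ) (𝓡 n) γ' (Ico 0 T) 0
        ((1 : ℝ →L[ℝ] ℝ).smulRight (v (γ' 0))) := by
      rw [hpos 0 le_rfl]
      exact (hγ 0 ⟨le_rfl, ht.2⟩).congr_mono (fun s hs => hpos s hs.1) (hpos 0 le_rfl) subset_rfl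
    refine (h1.union h2).hasMFDerivAt ?_
    filter_upwards [Ioo_mem_nhds (show -ε < 0 by linarith) ht.2] with s hs
    rcases le_total s 0 with h | h
    · exact Or.inl ⟨hs.1, h⟩
    · exact Or.inr ⟨h, hs.2⟩
  · have h1 : HasMFDerivAt 𝓘(ℝ, ℝ) (𝓡 n) γ t ((1 : ℝ →L[ℝ] ℝ).smulRight (v (γ t))) :=
      (hγ t ⟨h.le, ht.2⟩).hasMFDerivAt (Ico_mem_nhds h ht.2)
    rw [hpos t h.le]
    refine h1.congr_of_eventuallyEq ?_
    filter_upwards [Ioi_mem_nhds h] with s hs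
    exact hpos s hs.le

variable [IsManifold (𝓡 n) ∞ M]

variable [T2Space M]

/-- Uniqueness of integral curves to the right of the initial time. -/
lemma IsMIntegralCurveOn.eqOn_Ico {v : ∀ x : M, TangentSpace (𝓡 n) x} (hv : v ∈ smoothFields n M)
    {γ γ' : ℝ → M} {T : ℝ} (hγ : IsMIntegralCurveOn γ v (Ico 0 T))
    (hγ' : IsMIntegralCurveOn γ' v (Ico 0 T)) (h0 : γ 0 = γ' 0) : EqOn γ γ' (Ico 0 T) := by
  intro t ht
  have hM1 : IsManifold (𝓡 n) 1 M := IsManifold.of_le (n := ∞) (WithTop.coe_le_coe.2 le_top)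
  have hv1 : ContMDiff (𝓡 n) (𝓡 n).tangent 1 fun x => (⟨x, v x⟩ : TangentBundle (𝓡 n) M) :=
    ContMDiff.of_le (mem_smoothFields.1 hv) (WithTop.coe_le_coe.2 le_top)
  -- Uniqueness is available on open intervals around the initial time. Both curves are therefore
  -- continued to negative times by the same integral curve `σ`.
  obtain ⟨σ, hσ0, hσ⟩ := exists_isMIntegralCurveAt_of_contMDiffAt_boundaryless (t₀ := 0)
    (hv1 (γ 0))
  obtain ⟨ε, hε, hσ⟩ := isMIntegralCurveAt_iff'.1 hσ
  rw [Real.ball_eq_Ioo, zero_sub, zero_add] at hσ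
  have h := isMIntegralCurveOn_Ioo_eqOn_of_contMDiff_boundaryless (t₀ := 0) (a := -ε) (b := T)
    ⟨by linarith, ht.1.trans_lt ht.2⟩ hv1 (hγ.exists_extend_left hσ hε hσ0)
    (hγ'.exists_extend_left hσ hε (hσ0.trans h0)) (by simp [h0]) (x := t)
    ⟨by linarith [ht.1], ht.2⟩
  simpa [ht.1.not_gt] using h

lemma forwardFlow_eq_of_isMIntegralCurveOn {v : ∀ x : M, TangentSpace (𝓡 n) x}
    (hv : v ∈ smoothFields n M) (hc : ForwardComplete v) {γ : ℝ → M} {T : ℝ}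
    (hγ : IsMIntegralCurveOn γ v (Ico 0 T)) {t : ℝ} (ht : t ∈ Ico 0 T) :
    forwardFlow v t (γ 0) = γ t := by
  obtain ⟨h1, h2⟩ := exists_forwardFlow_eq hc (γ 0)
  exact (h1.mono (fun s hs => hs.1)).eqOn_Ico hv hγ h2 ht

lemma forwardFlow_add {v : ∀ x : M, TangentSpace (𝓡 n) x} (hv : v ∈ smoothFields n M)
    (hc : ForwardComplete v) {s t : ℝ} (hs : 0 ≤ s) (ht : 0 ≤ t) (η : M) :
    forwardFlow v (s + t) η = forwardFlow v t (forwardFlow v s η) := by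
  obtain ⟨h1, -⟩ := exists_forwardFlow_eq hc η
  have h2 : IsMIntegralCurveOn ((fun t => forwardFlow v t η) ∘ (· + s)) v (Ico 0 (t + 1)) :=
    (h1.comp_add s).mono fun r hr => add_nonneg hr.1 hs
  have h3 := forwardFlow_eq_of_isMIntegralCurveOn hv hc h2 (t := t) ⟨ht, by linarith⟩
  simp only [Function.comp_apply, zero_add] at h3
  rw [h3, add_comm]

/-- In a chart, the forward flow is the flow of the coordinate representation of the field. -/
lemma forwardFlow_extChartAt_symm {v : ∀ x : M, TangentSpace (𝓡 n) x} (hv : v ∈ smoothFields n M)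
    (hc : ForwardComplete v) {ξ : M} {r C ε : ℝ}
    {f : EuclideanSpace ℝ (Fin n) → EuclideanSpace ℝ (Fin n)}
    {Φ : ℝ → EuclideanSpace ℝ (Fin n) → EuclideanSpace ℝ (Fin n)}
    (hball : Metric.ball (extChartAt (𝓡 n) ξ ξ) r ⊆ (extChartAt (𝓡 n) ξ).target)
    (hC0 : 0 < C) (hC : ∀ x, ‖f x‖ ≤ C) (hΦ : IsLocalFlow f ε Φ)
    (hf : ∀ y ∈ Metric.ball (extChartAt (𝓡 n) ξ ξ) r, f y = chartField ξ v y)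
    {y : EuclideanSpace ℝ (Fin n)} {t : ℝ} (ht0 : 0 ≤ t) (htε : t < ε)
    (hy : dist y (extChartAt (𝓡 n) ξ ξ) + C * t < r) :
    forwardFlow v t ((extChartAt (𝓡 n) ξ).symm y) = (extChartAt (𝓡 n) ξ).symm (Φ t y) := by
  -- At speed at most `C` the curve cannot leave the ball of radius `r` before time `T`.
  set T := min ε ((r - dist y (extChartAt (𝓡 n) ξ ξ)) / C) with hT
  have htT : t < T := by
    rw [hT, lt_min_iff, lt_div_iff₀ hC0]
    exact ⟨htε, by linarith⟩
  have hmem : ∀ s ∈ Ico 0 T, Φ s y ∈ Metric.ball (extChartAt (𝓡 n) ξ ξ) r := by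
    rintro s ⟨hs0, hs⟩
    rw [hT, lt_min_iff, lt_div_iff₀ hC0] at hs
    have h1 := hΦ.dist_apply_le hC hs0 hs.1 y
    rw [Metric.mem_ball]
    linarith [dist_triangle (Φ s y) y (extChartAt (𝓡 n) ξ ξ)]
  have hcurve : IsMIntegralCurveOn (fun s => (extChartAt (𝓡 n) ξ).symm (Φ s y)) v (Ico 0 T) := by
    intro s hs
    have hsε : s < ε := hs.2.trans_le (min_le_left _ _)
    have hst := hball (hmem s hs)
    apply HasMFDerivAt.hasMFDerivWithinAt
    have h1 : HasMFDerivAt 𝓘(ℝ, ℝ) 𝓘(ℝ, EuclideanSpace ℝ (Fin n)) (fun s => Φ s y) s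
        ((1 : ℝ →L[ℝ] ℝ).smulRight (f (Φ s y))) :=
      ((hΦ.hasDerivAt s ⟨by linarith [hs.1], hsε⟩ y).hasFDerivAt).hasMFDerivAt
    have h2 := ((contMDiffAt_extChartAt_symm hst).mdifferentiableAt (by simp)).hasMFDerivAt
    have h3 := HasMFDerivAt.comp s h2 h1
    have h4 := mfderiv_chartField v hst
    rw [← hf _ (hmem s hs)] at h4
    have h5 : (mfderiv 𝓘(ℝ, EuclideanSpace ℝ (Fin n)) (𝓡 n) (extChartAt (𝓡 n) ξ).symm
        (Φ s y)).comp ((1 : ℝ →L[ℝ] ℝ).smulRight (f (Φ s y))) =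
        (1 : ℝ →L[ℝ] ℝ).smulRight (v ((extChartAt (𝓡 n) ξ).symm (Φ s y))) := by
      rw [← h4]
      refine ContinuousLinearMap.ext_ring ?_
      change (mfderiv 𝓘(ℝ, EuclideanSpace ℝ (Fin n)) (𝓡 n) (extChartAt (𝓡 n) ξ).symm
        (Φ s y)) ((1 : ℝ) • f (Φ s y)) = (1 : ℝ) • _
      rw [one_smul, one_smul]
    rw [← h5]
    exact h3
  have h := forwardFlow_eq_of_isMIntegralCurveOn hv hc hcurve (t := t) ⟨ht0, htT⟩
  simpa [hΦ.zero] using h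

/-- Near `ξ` and for small times the flow is, in the chart, a `C²` map with invertible differential.
Starting within `r / 2` of the center leaves time `r / 2 / C` before the chart ball is left. -/
lemma exists_nhds_nullRegularAt_forwardFlow {v : ∀ x : M, TangentSpace (𝓡 n) x}
    (hv : v ∈ smoothFields n M) (hc : ForwardComplete v) (ξ : M) :
    ∃ V ∈ 𝓝 ξ, ∃ τ > 0, ∀ t ∈ Ico 0 τ, ∀ z ∈ V, NullRegularAt n (forwardFlow v t) z := by
  obtain ⟨r, hr, hball, f, K, C, ε, Φ, hε, hC0, hfK, hfC, hΦ, hf⟩ :=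
    exists_localFlow_chartField (ι := Unit) (u := fun _ => v) ξ (fun _ => hv)
  specialize hfK ()
  specialize hfC ()
  specialize hΦ ()
  specialize hf ()
  set x₀ := extChartAt (𝓡 n) ξ ξ with hx₀
  set V : Set M := (extChartAt (𝓡 n) ξ).source ∩
    extChartAt (𝓡 n) ξ ⁻¹' Metric.ball x₀ (r / 2) with hV
  have hVo : IsOpen V := isOpen_extChartAt_preimage' (I := 𝓡 n) ξ Metric.isOpen_ball
  have hdist : ∀ t ∈ Ico 0 (min ε (r / 2 / C)), ∀ z ∈ V,
      t < ε ∧ dist (extChartAt (𝓡 n) ξ z) x₀ + C * t < r := by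
    rintro t ⟨ht0, ht⟩ z ⟨-, hz⟩
    rw [lt_min_iff, lt_div_iff₀ hC0] at ht
    rw [mem_preimage, Metric.mem_ball] at hz
    exact ⟨ht.1, by linarith⟩
  refine ⟨V, hVo.mem_nhds ⟨mem_extChartAt_source ξ, Metric.mem_ball_self (by positivity)⟩,
    min ε (r / 2 / C), lt_min hε (by positivity), fun t ht z hz => ?_⟩
  have hflow : ∀ z ∈ V, forwardFlow v t z =
      (extChartAt (𝓡 n) ξ).symm (Φ () t (extChartAt (𝓡 n) ξ z)) := by
    intro z hz
    obtain ⟨h1, h2⟩ := hdist t ht z hz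
    have h := forwardFlow_extChartAt_symm hv hc hball hC0 hfC hΦ hf ht.1 h1 h2
    rwa [(extChartAt (𝓡 n) ξ).left_inv hz.1] at h
  have htar : ∀ z ∈ V, Φ () t (extChartAt (𝓡 n) ξ z) ∈ (extChartAt (𝓡 n) ξ).target := by
    intro z hz
    obtain ⟨h1, h2⟩ := hdist t ht z hz
    refine hball ?_
    rw [Metric.mem_ball]
    linarith [hΦ.dist_apply_le hfC ht.1 h1 (extChartAt (𝓡 n) ξ z),
      dist_triangle (Φ () t (extChartAt (𝓡 n) ξ z)) (extChartAt (𝓡 n) ξ z) x₀]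
  have htε : t ∈ Ioo (-ε) ε := ⟨by linarith [ht.1], (hdist t ht z hz).1⟩
  have hcd : ContDiffAt ℝ 2 (Φ () t) (extChartAt (𝓡 n) ξ z) :=
    (hΦ.contDiffAt t htε (extChartAt (𝓡 n) ξ z)).comp (extChartAt (𝓡 n) ξ z)
      (contDiffAt_const.prodMk contDiffAt_id)
  constructor
  · have h1 : ContinuousAt (fun z => (extChartAt (𝓡 n) ξ).symm
        (Φ () t (extChartAt (𝓡 n) ξ z))) z :=
      ContinuousAt.comp (continuousAt_extChartAt_symm'' (htar z hz))
        (hcd.continuousAt.comp (continuousAt_extChartAt' hz.1))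
    refine h1.congr ?_
    filter_upwards [hVo.mem_nhds hz] with w hw using (hflow w hw).symm
  · have hstrict := hcd.hasStrictFDerivAt (by simp)
    have hsurj : Function.Surjective (fderiv ℝ (Φ () t) (extChartAt (𝓡 n) ξ z)) := by
      intro b
      have h1 := hΦ.fderiv_comp_fderiv_neg hfK htε (extChartAt (𝓡 n) ξ z)
      exact ⟨_, DFunLike.congr_fun h1 b⟩
    obtain ⟨U, hU, hUN⟩ := hstrict.exists_nhds_null_preimage volume volume hsurj
    refine ⟨V ∩ extChartAt (𝓡 n) ξ ⁻¹' U, inter_mem (hVo.mem_nhds hz)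
      ((continuousAt_extChartAt' hz.1).preimage_mem_nhds hU), fun N hN => ?_⟩
    refine ChartNull.of_subset_source (ξ := ξ) (fun w hw => hw.1.1.1)
      (measure_mono_null ?_ (hUN _ (hN ξ)))
    rintro y ⟨hy, ⟨hyV, hyU⟩, hyN⟩
    have h1 := htar _ hyV
    rw [mem_preimage, hflow _ hyV] at hyN
    rw [mem_preimage] at hyU
    rw [(extChartAt (𝓡 n) ξ).right_inv hy] at h1 hyN hyU
    exact ⟨hyU, h1, hyN⟩

/-- The trajectory on `[0, t]` is compact, so one step size works along all of it, and the flow for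
time `t` is a composition of finitely many short flows. -/
lemma nullRegularAt_forwardFlow {v : ∀ x : M, TangentSpace (𝓡 n) x}
    (hv : v ∈ smoothFields n M) (hc : ForwardComplete v) {t : ℝ} (ht : 0 ≤ t) (η : M) :
    NullRegularAt n (forwardFlow v t) η := by
  obtain ⟨h1, h0⟩ := exists_forwardFlow_eq hc η
  have hunif : ∃ τ > 0, ∀ s ∈ Icc 0 t, ∀ r ∈ Ico 0 τ,
      NullRegularAt n (forwardFlow v r) (forwardFlow v s η) := by
    refine isCompact_Icc.induction_on (p := fun A => ∃ τ > 0, ∀ s ∈ A, ∀ r ∈ Ico 0 τ,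
      NullRegularAt n (forwardFlow v r) (forwardFlow v s η)) ⟨1, one_pos, by simp⟩ ?_ ?_ ?_
    · rintro A B hAB ⟨τ, hτ, h⟩
      exact ⟨τ, hτ, fun s hs => h s (hAB hs)⟩
    · rintro A B ⟨τ, hτ, h⟩ ⟨τ', hτ', h'⟩
      refine ⟨min τ τ', lt_min hτ hτ', ?_⟩
      rintro s (hs | hs) r ⟨hr0, hr⟩
      · exact h s hs r ⟨hr0, hr.trans_le (min_le_left _ _)⟩
      · exact h' s hs r ⟨hr0, hr.trans_le (min_le_right _ _)⟩
    · intro s hs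
      obtain ⟨V, hV, τ, hτ, h⟩ := exists_nhds_nullRegularAt_forwardFlow hv hc (forwardFlow v s η)
      have h2 : ContinuousWithinAt (fun s => forwardFlow v s η) (Icc 0 t) s :=
        (h1.continuousOn s hs.1).mono Icc_subset_Ici_self
      exact ⟨_, h2.preimage_mem_nhdsWithin hV, τ, hτ, fun s hs r hr => h r hr _ hs⟩
  obtain ⟨τ, hτ, h⟩ := hunif
  obtain ⟨m, hm⟩ := exists_nat_gt (t / τ)
  have hm0 : (0 : ℝ) < m := (div_nonneg ht hτ.le).trans_lt hm
  have hstep : t / m < τ := by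
    rw [div_lt_iff₀ hτ] at hm
    rw [div_lt_iff₀ hm0]
    linarith
  have hind : ∀ j : ℕ, j ≤ m → NullRegularAt n (forwardFlow v (j * (t / m))) η := by
    intro j
    induction j with
    | zero =>
      intro _
      have h2 := h 0 ⟨le_rfl, ht⟩ 0 ⟨le_rfl, hτ⟩
      rw [h0] at h2
      simpa using h2
    | succ j ih =>
      intro hj
      have hj' : (j : ℝ) * (t / m) ≤ t := by
        calc (j : ℝ) * (t / m) ≤ m * (t / m) := by
              gcongr
              omega
          _ = t := by field_simp
      have h2 := (h (j * (t / m)) ⟨by positivity, hj'⟩ (t / m) ⟨by positivity, hstep⟩).comp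
        (ih (by omega))
      have h3 : forwardFlow v ((j + 1 : ℕ) * (t / m)) =
          forwardFlow v (t / m) ∘ forwardFlow v (j * (t / m)) := by
        funext z
        rw [Function.comp_apply, ← forwardFlow_add hv hc (by positivity) (by positivity)]
        congr 1
        push_cast
        ring
      rwa [h3]
  have h4 := hind m le_rfl
  rwa [mul_div_cancel₀ _ hm0.ne'] at h4

lemma continuous_forwardFlow {v : ∀ x : M, TangentSpace (𝓡 n) x} (hv : v ∈ smoothFields n M)
    (hc : ForwardComplete v) {t : ℝ} (ht : 0 ≤ t) : Continuous (forwardFlow v t) :=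
  continuous_iff_continuousAt.2 fun η => (nullRegularAt_forwardFlow hv hc ht η).1

/-- Preimages of null sets under the forward flow are null sets. -/
lemma ChartNull.preimage_forwardFlow {v : ∀ x : M, TangentSpace (𝓡 n) x}
    (hv : v ∈ smoothFields n M) (hc : ForwardComplete v) {t : ℝ} (ht : 0 ≤ t) {N : Set M}
    (hN : ChartNull n N) : ChartNull n (forwardFlow v t ⁻¹' N) := by
  refine ChartNull.of_locally fun x _ => ?_
  obtain ⟨-, U, hU, h⟩ := nullRegularAt_forwardFlow hv hc ht x
  exact ⟨U, hU, h N hN⟩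

/-- A map continuous in time for each point and continuous in the point for each time is jointly
measurable. Times are cut off at `0` because the flow is controlled only for nonnegative times. -/
lemma measurable_forwardFlow_max [SecondCountableTopology M] [MeasurableSpace M] [BorelSpace M]
    {v : ∀ x : M, TangentSpace (𝓡 n) x} (hv : v ∈ smoothFields n M) (hc : ForwardComplete v) :
    Measurable fun p : ℝ × M => forwardFlow v (max p.1 0) p.2 := by
  have : LocallyCompactSpace M := ChartedSpace.locallyCompactSpace (EuclideanSpace ℝ (Fin n)) M
  have : TopologicalSpace.MetrizableSpace M := Manifold.metrizableSpace (𝓡 n) M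
  refine measurable_uncurry_of_continuous_of_measurable (u := fun t η => forwardFlow v (max t 0) η)
    (fun η => ?_) (fun t => (continuous_forwardFlow hv hc (le_max_right t 0)).measurable)
  exact (exists_forwardFlow_eq hc η).1.continuousOn.comp_continuous (by fun_prop)
    (fun t => le_max_right t 0)

end ForwardFlow

/-! ### Null sets of the Riemannian volume -/

section RiemannianNull

open Set Filter Topology

variable {n : ℕ} {M : Type*} [TopologicalSpace M] [ChartedSpace (EuclideanSpace ℝ (Fin n)) M]
  [IsManifold (𝓡 n) ∞ M]

lemma continuousOn_coordVector (c : M) (j : Fin n) :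
    ContinuousOn (fun y => (⟨(chartAt (EuclideanSpace ℝ (Fin n)) c).symm y,
      coordVector (chartAt (EuclideanSpace ℝ (Fin n)) c) y j⟩ : TangentBundle (𝓡 n) M))
      (chartAt (EuclideanSpace ℝ (Fin n)) c).target := by
  set e := chartAt (EuclideanSpace ℝ (Fin n)) c
  have h1 : ContMDiffOn (𝓡 n) (𝓡 n) ∞ e.symm e.target := contMDiffOn_chart_symm
  have h2 := h1.continuousOn_tangentMapWithin (by simp) e.open_target.uniqueMDiffOn
  have h3 : Continuous (fun y => (⟨y, EuclideanSpace.single j (1 : ℝ)⟩ :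
      TangentBundle (𝓡 n) (EuclideanSpace ℝ (Fin n)))) :=
    ((contMDiff_vectorSpace_iff_contDiff (n := ∞)
      (V := fun _ => EuclideanSpace.single j (1 : ℝ))).2 contDiff_const).continuous
  refine (h2.comp h3.continuousOn (fun y hy => hy)).congr fun y hy => ?_
  simp only [Function.comp_apply, tangentMapWithin, coordVector]
  rw [mfderivWithin_of_isOpen e.open_target hy]

lemma continuousOn_volumeDensity (g : SmoothMetric n M) (c : M) :
    ContinuousOn (volumeDensity g (chartAt (EuclideanSpace ℝ (Fin n)) c))
      (chartAt (EuclideanSpace ℝ (Fin n)) c).target := by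
  set e := chartAt (EuclideanSpace ℝ (Fin n)) c
  have h : ∀ j l : Fin n, ContinuousOn (fun y => g.inner (e.symm y) (coordVector e y j)
      (coordVector e y l)) e.target := by
    intro j l y hy
    have h1 : ContinuousWithinAt (fun m ↦ (⟨e.symm m, g.inner (e.symm m) (coordVector e m j)
        (coordVector e m l)⟩ : Bundle.TotalSpace ℝ (Bundle.Trivial M ℝ))) e.target y :=
      (g.contMDiff.continuous.continuousAt.comp_continuousWithinAt
        (e.continuousOn_symm y hy)).clm_bundle_apply₂ (F₁ := EuclideanSpace ℝ (Fin n))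
        (F₂ := EuclideanSpace ℝ (Fin n)) (continuousOn_coordVector c j y hy)
        (continuousOn_coordVector c l y hy)
    simp only [FiberBundle.continuousWithinAt_totalSpace] at h1
    exact h1.2
  refine Real.continuous_sqrt.comp_continuousOn ?_
  have h2 : ContinuousOn (fun y => Matrix.of fun j l : Fin n => g.inner (e.symm y)
      (coordVector e y j) (coordVector e y l)) e.target :=
    continuousOn_pi.2 fun j => continuousOn_pi.2 fun l => h j l
  exact (continuous_id.matrix_det).comp_continuousOn h2

/-- The Gram matrix of linearly independent vectors is positive definite; the coordinate vectors are
independent because the differential of the chart inverse is injective. -/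
lemma volumeDensity_pos (g : SmoothMetric n M) (c : M) {y : EuclideanSpace ℝ (Fin n)}
    (hy : y ∈ (chartAt (EuclideanSpace ℝ (Fin n)) c).target) :
    0 < volumeDensity g (chartAt (EuclideanSpace ℝ (Fin n)) c) y := by
  set e := chartAt (EuclideanSpace ℝ (Fin n)) c
  refine Real.sqrt_pos.2 (Matrix.PosDef.det_pos (Matrix.PosDef.of_dotProduct_mulVec_pos ?_ ?_))
  · ext j l
    simpa using g.symm _ _ _
  · intro x hx
    have hinv : (mfderiv (𝓡 n) (𝓡 n) e.symm y).IsInvertible :=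
      isInvertible_mfderiv_extChartAt_symm (ξ := c) (by simpa using hy)
    have hinj : Function.Injective (mfderiv (𝓡 n) (𝓡 n) e.symm y) := hinv.injective
    set V : TangentSpace (𝓡 n) (e.symm y) := ∑ j, x j • coordVector e y j with hV
    have hV' : V = mfderiv (𝓡 n) (𝓡 n) e.symm y (WithLp.toLp 2 x : EuclideanSpace ℝ (Fin n)) := by
      have h1 : (WithLp.toLp 2 x : EuclideanSpace ℝ (Fin n)) =
          ∑ j, x j • EuclideanSpace.single j (1 : ℝ) := by
        ext l
        simp [Finset.sum_apply, Pi.single_apply]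
      rw [h1]
      exact ((map_sum (mfderiv (𝓡 n) (𝓡 n) e.symm y) _ _).trans
        (Finset.sum_congr rfl fun j _ => map_smul _ _ _)).symm
    have hV0 : V ≠ 0 := by
      rw [hV']
      intro h
      apply hx
      have h2 := hinj (h.trans (map_zero (mfderiv (𝓡 n) (𝓡 n) e.symm y)).symm)
      exact congrArg (WithLp.ofLp (p := 2)) h2
    have hpos := g.pos _ V hV0
    have heq : g.inner (e.symm y) V V = star x ⬝ᵥ (Matrix.of fun j l : Fin n =>
        g.inner (e.symm y) (coordVector e y j) (coordVector e y l)).mulVec x := by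
      simp only [hV, map_sum, map_smul, sum_apply,
        smul_apply, dotProduct, Matrix.mulVec, Matrix.of_apply, smul_eq_mul,
        star_trivial]
      refine Finset.sum_congr rfl fun j _ => congrArg _ (Finset.sum_congr rfl fun l _ => ?_)
      rw [mul_comm, g.symm]
    rwa [← heq]

variable [T2Space M] [SecondCountableTopology M] [MeasurableSpace M] [BorelSpace M]

/-- Null sets of a Riemannian volume measure are null sets in all charts. -/
lemma ChartNull.of_lebesgueMeasure_eq_zero (g : SmoothMetric n M) {N : Set M}
    (hN : lebesgueMeasure g N = 0) : ChartNull n N := by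
  suffices h : ∀ N : Set M, MeasurableSet N → lebesgueMeasure g N = 0 → ChartNull n N from
    (h _ (measurableSet_toMeasurable _ N) (by rwa [measure_toMeasurable])).mono
      (subset_toMeasurable _ N)
  clear hN N
  intro N hNm hN
  refine ChartNull.of_locally fun x _ => ?_
  -- Where the partition function of the chart at `c` is positive, the summand of `c` alone has
  -- positive density, so its null sets are Lebesgue null.
  obtain ⟨c, hc⟩ := (chartPartition n M).exists_pos_of_mem (mem_univ x)
  set ρ := chartPartition n M c with hρ
  set e := chartAt (EuclideanSpace ℝ (Fin n)) c with he
  have hsub : {z | 0 < ρ z} ⊆ e.source := fun z hz =>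
    (exists_chartPartition n M).choose_spec c (subset_closure (ne_of_gt hz))
  refine ⟨{z | 0 < ρ z}, (isOpen_lt continuous_const ρ.contMDiff.continuous).mem_nhds hc,
    ChartNull.of_subset_source (ξ := c) (fun z hz => by simpa using hsub hz.1) ?_⟩
  have hdens : AEMeasurable (fun y => ENNReal.ofReal (ρ (e.symm y) * volumeDensity g e y))
      (volume.restrict e.target) := by
    refine AEMeasurable.ennreal_ofReal (ContinuousOn.aemeasurable ?_ e.open_target.measurableSet)
    exact (ρ.contMDiff.continuous.comp_continuousOn e.continuousOn_symm).mul
      (continuousOn_volumeDensity g c)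
  have hsymm : AEMeasurable e.symm ((volume.restrict e.target).withDensity fun y =>
      ENNReal.ofReal (ρ (e.symm y) * volumeDensity g e y)) :=
    (e.continuousOn_symm.aemeasurable e.open_target.measurableSet).mono_ac
      (withDensity_absolutelyContinuous _ _)
  have h1 := hN
  rw [lebesgueMeasure, Measure.sum_apply _ hNm, ENNReal.tsum_eq_zero] at h1
  have h2 := h1 c
  rw [Measure.map_apply_of_aemeasurable hsymm hNm, withDensity_apply_eq_zero' hdens,
    Measure.restrict_apply' e.open_target.measurableSet] at h2
  refine measure_mono_null ?_ h2
  rintro y ⟨hy, hyρ, hyN⟩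
  have hy' : y ∈ e.target := by simpa using hy
  refine ⟨⟨?_, hyN⟩, hy'⟩
  have h3 : 0 < ρ (e.symm y) * volumeDensity g e y := mul_pos hyρ (volumeDensity_pos g c hy')
  simpa using h3

end RiemannianNull

/-! ### Null sets, sections and exponential laws -/

section NullSections

open Set

/-- A set of vectors is null if and only if almost all its sections along the last coordinate are
null. -/
lemma volume_eq_zero_iff_snoc {m : ℕ} {D : Set (Fin (m + 1) → ℝ)} (hD : MeasurableSet D) :
    volume D = 0 ↔
      volume {s : Fin m → ℝ | volume {a : ℝ | (Fin.snoc s a : Fin (m + 1) → ℝ) ∈ D} ≠ 0} = 0 := by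
  have h1 := volume_preserving_piFinSuccAbove (fun _ : Fin (m + 1) => ℝ) (Fin.last m)
  have h2 := h1.symm.comp (Measure.measurePreserving_swap (μ := (volume : Measure (Fin m → ℝ)))
    (ν := (volume : Measure ℝ)))
  rw [← h2.measure_preimage hD.nullMeasurableSet,
    Measure.measure_prod_null (h2.measurable hD), Filter.EventuallyEq, ae_iff]
  have h3 : ∀ (s : Fin m → ℝ) (a : ℝ),
      (MeasurableEquiv.piFinSuccAbove (fun _ : Fin (m + 1) => ℝ) (Fin.last m)).symm (a, s) =
        (Fin.snoc s a : Fin (m + 1) → ℝ) := by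
    intro s a
    change (Fin.insertNth (Fin.last m) a s : Fin (m + 1) → ℝ) = _
    rw [Fin.insertNth_last']
  have h4 : ∀ s : Fin m → ℝ, Prod.mk s ⁻¹' ((MeasurableEquiv.piFinSuccAbove
      (fun _ : Fin (m + 1) => ℝ) (Fin.last m)).symm ∘ Prod.swap ⁻¹' D) =
        {a : ℝ | (Fin.snoc s a : Fin (m + 1) → ℝ) ∈ D} := by
    intro s
    ext a
    change (MeasurableEquiv.piFinSuccAbove (fun _ : Fin (m + 1) => ℝ) (Fin.last m)).symm (a, s) ∈ D
      ↔ _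
    rw [h3]
    rfl
  simp only [h4, Pi.zero_apply, ne_eq]

lemma measurable_snoc (m : ℕ) :
    Measurable fun p : (Fin m → ℝ) × ℝ => (Fin.snoc p.1 p.2 : Fin (m + 1) → ℝ) := by
  refine measurable_pi_lambda _ fun l => ?_
  refine Fin.lastCases ?_ (fun l => ?_) l
  · simpa using measurable_snd
  · simp only [Fin.snoc_castSucc]
    fun_prop

lemma measurableSet_volume_snoc_ne_zero {m : ℕ} {D : Set (Fin (m + 1) → ℝ)}
    (hD : MeasurableSet D) : MeasurableSet
      {s : Fin m → ℝ | volume {a : ℝ | (Fin.snoc s a : Fin (m + 1) → ℝ) ∈ D} ≠ 0} := by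
  exact (measurable_measure_prodMk_left (ν := (volume : Measure ℝ)) (measurable_snoc m hD))
    (measurableSet_singleton 0).compl

lemma volume_inter_Ioi_eq_zero_of_expMeasure {r : ℝ} (hr : 0 < r) {B : Set ℝ}
    (h : expMeasure r B = 0) : volume (B ∩ Ioi 0) = 0 := by
  have hm : AEMeasurable (gammaPDF 1 r) volume :=
    (measurable_gammaPDFReal 1 r).ennreal_ofReal.aemeasurable
  rw [expMeasure, gammaMeasure, withDensity_apply_eq_zero' hm] at h
  refine measure_mono_null ?_ h
  rintro x ⟨hx, hx0⟩
  exact ⟨(ENNReal.ofReal_pos.2 (gammaPDFReal_pos one_pos hr hx0)).ne', hx⟩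

lemma expMeasure_Iio_zero (r : ℝ) : expMeasure r (Iio 0) = 0 := by
  have hm : AEMeasurable (gammaPDF 1 r) volume :=
    (measurable_gammaPDFReal 1 r).ennreal_ofReal.aemeasurable
  rw [expMeasure, gammaMeasure, withDensity_apply_eq_zero' hm]
  convert measure_empty (μ := volume (α := ℝ))
  ext x
  simp only [mem_inter_iff, mem_ofPred, mem_Iio, mem_empty_iff_false, iff_false, not_and, not_lt]
  intro h
  by_contra! h0
  exact h (gammaPDF_of_neg h0)

end NullSections

/-! ### The law of regimes and holding times -/

namespace SwitchingSystem

open Set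

variable {n k : ℕ} {M : Type*} [TopologicalSpace M]
  [ChartedSpace (EuclideanSpace ℝ (Fin n)) M] [IsManifold (𝓡 n) ∞ M] (Z : SwitchingSystem n k M)

instance (i : Fin k) : IsProbabilityMeasure (Z.pathLaw i) := by
  unfold pathLaw
  infer_instance

lemma map_apply_zero_pathLaw (i : Fin k) :
    (Z.pathLaw i).map (fun x => x 0) = Measure.dirac i ⊗ₘ Z.holdingKernel := by
  have h1 : (Z.pathLaw i).map (Preorder.frestrictLe 0) = (Measure.dirac i ⊗ₘ Z.holdingKernel).map
      (MeasurableEquiv.piUnique (fun _ : Finset.Iic 0 => Fin k × ℝ)).symm := by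
    rw [pathLaw, Kernel.trajMeasure, Measure.map_comp _ _ (by fun_prop),
      Kernel.traj_map_frestrictLe, Kernel.partialTraj_self, Measure.id_comp]
  have h2 : (fun x : ℕ → Fin k × ℝ => x 0) =
      (MeasurableEquiv.piUnique (fun _ : Finset.Iic 0 => Fin k × ℝ)) ∘
        (Preorder.frestrictLe (π := fun _ => Fin k × ℝ) 0) := rfl
  rw [h2, ← Measure.map_map (by fun_prop) (by fun_prop), h1, Measure.map_map (by fun_prop)
    (by fun_prop), MeasurableEquiv.self_comp_symm, Measure.map_id]

/-- The Markov property of the path law in integrated form: the next regime and holding time are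
drawn from `stepKernel` at the current regime. -/
lemma pathLaw_apply_succ (i : Fin k) (m : ℕ)
    {S : Set ((∀ _ : Finset.Iic m, Fin k × ℝ) × (Fin k × ℝ))} (hS : MeasurableSet S) :
    Z.pathLaw i {x | (Preorder.frestrictLe m x, x (m + 1)) ∈ S} =
      ∫⁻ x, Z.stepKernel (x m).1 (Prod.mk (Preorder.frestrictLe m x) ⁻¹' S) ∂Z.pathLaw i := by
  have h1 := Kernel.map_frestrictLe_trajMeasure_compProd_eq_map_trajMeasure
    (X := fun _ => Fin k × ℝ) (κ := Z.pathKernel) (μ₀ := Measure.dirac i ⊗ₘ Z.holdingKernel) (a := m)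
  have h2 := congrArg (fun μ => μ S) h1
  rw [Measure.compProd_apply hS, Measure.map_apply (by fun_prop) hS,
    lintegral_map (Kernel.measurable_kernel_prodMk_left hS) (by fun_prop)] at h2
  exact h2.symm

lemma measurable_stepKernel_frestrictLe (m : ℕ)
    {S : Set ((∀ _ : Finset.Iic m, Fin k × ℝ) × (Fin k × ℝ))} (hS : MeasurableSet S) :
    Measurable fun x : ℕ → Fin k × ℝ =>
      Z.stepKernel (x m).1 (Prod.mk (Preorder.frestrictLe m x) ⁻¹' S) := by
  have h1 : Measurable fun h : (∀ _ : Finset.Iic m, Fin k × ℝ) =>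
      Z.pathKernel m h (Prod.mk h ⁻¹' S) := Kernel.measurable_kernel_prodMk_left hS
  have h2 : Measurable (Preorder.frestrictLe (π := fun _ : ℕ => Fin k × ℝ) m) := by fun_prop
  have h3 := h1.comp h2
  have h4 : (fun h : (∀ _ : Finset.Iic m, Fin k × ℝ) => Z.pathKernel m h (Prod.mk h ⁻¹' S)) ∘
      Preorder.frestrictLe (π := fun _ : ℕ => Fin k × ℝ) m = fun x : ℕ → Fin k × ℝ =>
        Z.stepKernel (x m).1 (Prod.mk (Preorder.frestrictLe m x) ⁻¹' S) := by
    funext x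
    rw [Function.comp_apply, pathKernel, Kernel.comap_apply]
    rfl
  rw [h4] at h3
  exact h3

lemma stepKernel_prod (i j : Fin k) {B : Set ℝ} (hB : MeasurableSet B) :
    Z.stepKernel i ({j} ×ˢ B) = expMeasure (Z.rate j) B * Z.jump i j := by
  change ((Z.jump i).toMeasure ⊗ₘ Z.holdingKernel) _ = _
  rw [Measure.compProd_apply_prod (measurableSet_singleton j) hB, lintegral_singleton,
    PMF.toMeasure_apply_singleton _ _ (measurableSet_singleton j)]
  rfl

lemma stepKernel_snd_neg (i : Fin k) : Z.stepKernel i (univ ×ˢ Iio 0) = 0 := by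
  change ((Z.jump i).toMeasure ⊗ₘ Z.holdingKernel) _ = _
  rw [Measure.compProd_apply_prod MeasurableSet.univ measurableSet_Iio]
  have h : ∀ a, Z.holdingKernel a (Iio 0) = 0 := fun a => expMeasure_Iio_zero (Z.rate a)
  simp [h]

/-- The holding times are almost surely nonnegative. -/
lemma ae_holding_nonneg (i : Fin k) : ∀ᵐ x ∂Z.pathLaw i, ∀ m, 0 ≤ (x m).2 := by
  rw [ae_all_iff]
  rintro (_ | m)
  · have h1 : ∀ᵐ p ∂(Z.pathLaw i).map (fun x => x 0), 0 ≤ p.2 := by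
      rw [map_apply_zero_pathLaw, Measure.ae_compProd_iff (measurableSet_le measurable_const
        measurable_snd), ae_dirac_iff]
      · rw [ae_iff]
        simp only [not_le]
        exact expMeasure_Iio_zero _
      · exact MeasurableSet.of_discrete
    exact ae_of_ae_map (f := fun x : ℕ → Fin k × ℝ => x 0)
      (measurable_pi_apply 0).aemeasurable h1
  · rw [ae_iff]
    have h1 := Z.pathLaw_apply_succ i m (S := univ ×ˢ (univ ×ˢ Iio 0))
      (MeasurableSet.univ.prod (MeasurableSet.univ.prod measurableSet_Iio))
    have h2 : ∀ h : (∀ _ : Finset.Iic m, Fin k × ℝ), Prod.mk h ⁻¹'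
        ((univ : Set (∀ _ : Finset.Iic m, Fin k × ℝ)) ×ˢ ((univ : Set (Fin k)) ×ˢ Iio (0 : ℝ))) =
          univ ×ˢ Iio 0 := fun h => by ext; simp
    simp only [h2, stepKernel_snd_neg, lintegral_zero] at h1
    rw [← h1]
    congr 1
    ext x
    simp

/-- Every admissible sequence of regimes together with every set of holding times of positive
Lebesgue measure occurs with positive probability. -/
lemma pathLaw_ne_zero (i : Fin k) (w : ℕ → Fin k) (hw0 : w 0 = i) (m : ℕ)
    (hw : ∀ l < m, w l ≠ w (l + 1)) {D : Set (Fin (m + 1) → ℝ)} (hD : MeasurableSet D)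
    (hpos : ∀ s ∈ D, ∀ l, 0 < s l) (hvol : volume D ≠ 0) :
    Z.pathLaw i {x | (∀ l ≤ m, (x l).1 = w l) ∧ (fun l : Fin (m + 1) => (x l).2) ∈ D} ≠ 0 := by
  induction m with
  | zero =>
    have h1 : Z.pathLaw i {x | (∀ l ≤ 0, (x l).1 = w l) ∧ (fun l : Fin 1 => (x l).2) ∈ D} =
        expMeasure (Z.rate i) ((fun a (_ : Fin 1) => a) ⁻¹' D) := by
      have h2 := congrArg (fun μ => μ ({i} ×ˢ ((fun a (_ : Fin 1) => a) ⁻¹' D)))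
        (Z.map_apply_zero_pathLaw i)
      have hm : MeasurableSet ((fun (a : ℝ) (_ : Fin 1) => a) ⁻¹' D) := hD.preimage (by fun_prop)
      rw [Measure.map_apply (by fun_prop) ((measurableSet_singleton i).prod hm),
        Measure.compProd_apply_prod (measurableSet_singleton i) hm, lintegral_singleton] at h2
      simp only [Measure.dirac_apply_of_mem (mem_singleton i), mul_one] at h2
      refine Eq.trans ?_ h2
      congr 1
      ext x
      simp [hw0]
    rw [h1]
    intro h
    apply hvol
    have h2 := volume_inter_Ioi_eq_zero_of_expMeasure (Z.rate_pos i) h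
    refine ((volume_preserving_funUnique (Fin 1) ℝ).symm.measure_preimage
      hD.nullMeasurableSet).symm.trans (measure_mono_null ?_ h2)
    intro a ha
    exact ⟨ha, hpos _ ha 0⟩
  | succ m ih =>
    -- By Fubini the initial times whose section of `D` has positive length form a set of positive
    -- volume, to which the induction hypothesis applies.
    set S := {s : Fin (m + 1) → ℝ | volume {a : ℝ | (Fin.snoc s a : Fin (m + 2) → ℝ) ∈ D} ≠ 0}
      with hS
    have hSm : MeasurableSet S := measurableSet_volume_snoc_ne_zero hD
    have h1 := ih (fun l hl => hw l (by omega)) hSm (fun s hs l => by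
      obtain ⟨a, ha⟩ := nonempty_of_measure_ne_zero hs
      simpa using hpos _ ha l.castSucc) fun h => hvol ((volume_eq_zero_iff_snoc hD).2 h)
    set T : Set ((∀ _ : Finset.Iic m, Fin k × ℝ) × (Fin k × ℝ)) :=
      {p | (∀ l : Finset.Iic m, (p.1 l).1 = w l) ∧ p.2.1 = w (m + 1) ∧
        (Fin.snoc (fun l : Fin (m + 1) => (p.1 ⟨l, Finset.mem_Iic.2 (by omega)⟩).2) p.2.2 :
          Fin (m + 2) → ℝ) ∈ D} with hT
    have hTm : MeasurableSet T := by
      have hT1 : ∀ l : Finset.Iic m, MeasurableSet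
          {p : (∀ _ : Finset.Iic m, Fin k × ℝ) × (Fin k × ℝ) | (p.1 l).1 = w l} := fun l =>
        measurableSet_eq_fun (by fun_prop) measurable_const
      have hT2 : MeasurableSet
          {p : (∀ _ : Finset.Iic m, Fin k × ℝ) × (Fin k × ℝ) | p.2.1 = w (m + 1)} :=
        measurableSet_eq_fun (by fun_prop) measurable_const
      have hT4 : Measurable fun p : (∀ _ : Finset.Iic m, Fin k × ℝ) × (Fin k × ℝ) =>
          ((fun l : Fin (m + 1) => (p.1 ⟨l, Finset.mem_Iic.2 (by omega)⟩).2), p.2.2) := by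
        fun_prop
      have hT3 : Measurable fun p : (∀ _ : Finset.Iic m, Fin k × ℝ) × (Fin k × ℝ) =>
          (Fin.snoc (fun l : Fin (m + 1) => (p.1 ⟨l, Finset.mem_Iic.2 (by omega)⟩).2) p.2.2 :
            Fin (m + 2) → ℝ) :=
        (measurable_snoc (m + 1)).comp hT4
      convert (MeasurableSet.iInter hT1).inter (hT2.inter (hT3 hD)) using 1
      ext p
      simp [hT]
    have h2 := Z.pathLaw_apply_succ i m hTm
    have h3 : {x : ℕ → Fin k × ℝ | (Preorder.frestrictLe m x, x (m + 1)) ∈ T} =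
        {x | (∀ l ≤ m + 1, (x l).1 = w l) ∧ (fun l : Fin (m + 2) => (x l).2) ∈ D} := by
      ext x
      have h5 : (Fin.snoc (fun l : Fin (m + 1) => (x l).2) (x (m + 1)).2 : Fin (m + 2) → ℝ) =
          fun l : Fin (m + 2) => (x l).2 := by
        funext l
        refine Fin.lastCases ?_ (fun l => ?_) l <;> simp
      change ((∀ l : Finset.Iic m, (x l).1 = w l) ∧ (x (m + 1)).1 = w (m + 1) ∧
        (Fin.snoc (fun l : Fin (m + 1) => (x l).2) (x (m + 1)).2 : Fin (m + 2) → ℝ) ∈ D) ↔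
          (∀ l ≤ m + 1, (x l).1 = w l) ∧ (fun l : Fin (m + 2) => (x l).2) ∈ D
      rw [h5, ← and_assoc]
      refine and_congr_left fun _ => ⟨fun h l hl => ?_, fun h =>
        ⟨fun l => h l (by have := Finset.mem_Iic.1 l.2; omega), h _ le_rfl⟩⟩
      rcases hl.lt_or_eq with hl | rfl
      · exact h.1 ⟨l, Finset.mem_Iic.2 (by omega)⟩
      · exact h.2
    rw [← h3, h2]
    intro h4
    rw [lintegral_eq_zero_iff (Z.measurable_stepKernel_frestrictLe m hTm), Filter.EventuallyEq, ae_iff] at h4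
    -- On the event of the induction hypothesis the integrand is a positive jump probability times
    -- the exponential measure of a section of positive length; it cannot vanish almost everywhere.
    refine h1 (measure_mono_null ?_ h4)
    rintro x ⟨hxw, hxS⟩ h5
    have h6 : Prod.mk (Preorder.frestrictLe m x) ⁻¹' T = {w (m + 1)} ×ˢ
        {a : ℝ | (Fin.snoc (fun l : Fin (m + 1) => (x l).2) a : Fin (m + 2) → ℝ) ∈ D} := by
      ext p
      change ((∀ l : Finset.Iic m, (x l).1 = w l) ∧ p.1 = w (m + 1) ∧ p.2 ∈
        {a : ℝ | (Fin.snoc (fun l : Fin (m + 1) => (x l).2) a : Fin (m + 2) → ℝ) ∈ D}) ↔ _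
      rw [mem_prod, mem_singleton_iff, and_iff_right]
      exact fun l => hxw l (Finset.mem_Iic.1 l.2)
    have hBm : MeasurableSet
        {a : ℝ | (Fin.snoc (fun l : Fin (m + 1) => (x l).2) a : Fin (m + 2) → ℝ) ∈ D} :=
      (measurable_snoc (m + 1)).comp
        (measurable_prodMk_left (x := fun l : Fin (m + 1) => (x l).2)) hD
    rw [h6, stepKernel_prod _ _ _ hBm, hxw m le_rfl, Pi.zero_apply, mul_eq_zero] at h5
    rcases h5 with h5 | h5
    · refine hxS (measure_mono_null ?_ (volume_inter_Ioi_eq_zero_of_expMeasure (Z.rate_pos _) h5))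
      intro a ha
      exact ⟨ha, by simpa using hpos _ ha (Fin.last _)⟩
    · exact (Z.jump_pos _ _ (hw m (by omega))).ne' h5

end SwitchingSystem

/-! ### A criterion for an absolutely continuous component -/

section LebesgueDecomposition

open Set Filter Topology

/-- A finite measure which is not carried by a null set has a nonzero absolutely continuous
component. -/
lemma hasNonzeroACComponent_of_forall_null {α : Type*} [MeasurableSpace α] (μ ν : Measure α)
    [IsFiniteMeasure μ] (h : ∀ N, MeasurableSet N → ν N = 0 → μ Nᶜ ≠ 0) :
    HasNonzeroACComponent μ ν := by
  set S : Set ENNReal := {c | ∃ N, MeasurableSet N ∧ ν N = 0 ∧ μ N = c} with hS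
  obtain ⟨c, -, hc, hcS⟩ := exists_seq_tendsto_sSup (S := S)
    ⟨0, ∅, MeasurableSet.empty, by simp, by simp⟩ (OrderTop.bddAbove S)
  choose N hNm hN0 hNc using hcS
  -- This null set attains the supremum of `μ` over null sets; a null set of positive measure
  -- outside it could be added and would exceed the supremum.
  set N' := ⋃ p, N p with hN'
  have hm : MeasurableSet N' := MeasurableSet.iUnion hNm
  have h0 : ν N' = 0 := measure_iUnion_null hN0
  have hmax : ∀ B, MeasurableSet B → ν B = 0 → μ B ≤ μ N' := by
    intro B hB hB0
    refine (le_sSup (a := μ B) (s := S) ⟨B, hB, hB0, rfl⟩).trans (le_of_tendsto' hc fun p => ?_)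
    rw [← hNc p]
    exact measure_mono (subset_iUnion N p)
  refine ⟨μ.restrict N'ᶜ, μ.restrict N', ?_, ?_, ?_, ?_⟩
  · rw [add_comm, Measure.restrict_add_restrict_compl hm]
  · refine Measure.AbsolutelyContinuous.mk fun B hB hB0 => ?_
    have h1 := hmax (N' ∪ B) (hm.union hB) (measure_union_null h0 hB0)
    rw [Measure.restrict_apply hB, ← sdiff_eq]
    rw [← union_sdiff_self, measure_union disjoint_sdiff_self_right (hB.diff hm)] at h1
    by_contra hne
    exact absurd h1 (not_le.2 (ENNReal.lt_add_right (measure_ne_top μ _) hne))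
  · exact ⟨N'ᶜ, hm.compl, by rw [Measure.restrict_apply hm.compl]; simp, by rwa [compl_compl]⟩
  · intro h1
    apply h N' hm h0
    rw [← Measure.restrict_apply_self, h1]
    rfl

end LebesgueDecomposition

/-! ### Measurability of the process -/

namespace SwitchingSystem

open Set

variable {n k : ℕ} {M : Type*} [TopologicalSpace M]
  [ChartedSpace (EuclideanSpace ℝ (Fin n)) M] [IsManifold (𝓡 n) ∞ M] (Z : SwitchingSystem n k M)

lemma switchTime_succ (path : ℕ → Fin k × ℝ) (m : ℕ) :
    switchTime path (m + 1) = switchTime path m + (path m).2 :=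
  Finset.sum_range_succ _ _

lemma measurable_switchTime (m : ℕ) :
    Measurable fun path : ℕ → Fin k × ℝ => switchTime path m := by
  unfold switchTime
  fun_prop

/-- This also holds on the exceptional paths: there the count has the default value `0`, and the
switch with index `0` is at time `0`. -/
lemma switchTime_switchCount_le (path : ℕ → Fin k × ℝ) {t : ℝ} (ht : 0 ≤ t) :
    switchTime path (switchCount path t) ≤ t := by
  rcases h : switchCount path t with _ | m
  · simpa [switchTime] using ht
  · by_contra! h1
    have h2 : switchCount path t ≤ m := Nat.sInf_le h1
    omega

lemma switchCount_eq_of_lt (path : ℕ → Fin k × ℝ) {t : ℝ} {m : ℕ}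
    (h1 : t < switchTime path (m + 1)) (h2 : ∀ l < m, switchTime path (l + 1) ≤ t) :
    switchCount path t = m := by
  refine le_antisymm (Nat.sInf_le h1) ?_
  by_contra! h
  exact (h2 _ h).not_gt (Nat.sInf_mem (s := {m | t < switchTime path (m + 1)}) ⟨m, h1⟩)

lemma measurable_switchCount (t : ℝ) :
    Measurable fun path : ℕ → Fin k × ℝ => switchCount path t := by
  refine measurable_to_countable' fun m => ?_
  have hlt : ∀ l, MeasurableSet {path : ℕ → Fin k × ℝ | t < switchTime path (l + 1)} := fun l =>
    measurableSet_lt measurable_const (measurable_switchTime (l + 1))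
  have hfirst : MeasurableSet ({path : ℕ → Fin k × ℝ | t < switchTime path (m + 1)} ∩
      ⋂ l : Fin m, {path : ℕ → Fin k × ℝ | t < switchTime path (l + 1)}ᶜ) :=
    (hlt m).inter (MeasurableSet.iInter fun l : Fin m => (hlt l).compl)
  -- If no switch occurs after `t`, the infimum of the empty set makes the count `0`.
  have hnone : MeasurableSet
      {path : ℕ → Fin k × ℝ | m = 0 ∧ ∀ l, ¬ t < switchTime path (l + 1)} := by
    convert (MeasurableSet.const (m = 0)).inter (MeasurableSet.iInter fun l => (hlt l).compl) using 1
    ext path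
    simp
  convert hfirst.union hnone using 1
  ext path
  simp only [mem_preimage, mem_singleton_iff, mem_union, mem_inter_iff, mem_iInter, mem_compl_iff,
    mem_ofPred]
  constructor
  · intro h
    by_cases hne : ∃ l, t < switchTime path (l + 1)
    · left
      have h1 := Nat.sInf_mem (s := {m | t < switchTime path (m + 1)}) hne
      rw [← h]
      refine ⟨h1, fun l => ?_⟩
      exact Nat.notMem_of_lt_sInf (s := {m | t < switchTime path (m + 1)}) (h ▸ l.2)
    · right
      push Not at hne
      refine ⟨?_, fun l => (hne l).not_gt⟩
      rw [← h, switchCount, Nat.sInf_eq_zero]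
      right
      ext l
      simpa using hne l
  · rintro (⟨h1, h2⟩ | ⟨rfl, h⟩)
    · exact switchCount_eq_of_lt path h1 fun l hl => not_lt.1 (h2 ⟨l, hl⟩)
    · rw [switchCount, Nat.sInf_eq_zero]
      right
      ext l
      simpa using h l

lemma measurable_regime (t : ℝ) : Measurable fun path : ℕ → Fin k × ℝ => regime path t := by
  have h1 : Measurable fun p : ℕ × (ℕ → Fin k × ℝ) => (p.2 p.1).1 :=
    measurable_from_prod_countable_right fun m => by fun_prop
  exact h1.comp ((measurable_switchCount t).prodMk measurable_id)

lemma field_mem_smoothFields (i : Fin k) : Z.field i ∈ smoothFields n M := Z.smooth i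

/-- A single regime would leave no target for the jump distribution, whose total mass is `1`. -/
lemma nontrivial_regimes (Z : SwitchingSystem n k M) (i : Fin k) : Nontrivial (Fin k) := by
  by_contra h
  rw [not_nontrivial_iff_subsingleton] at h
  have h2 := (Z.jump i).tsum_coe
  have h3 : ∀ j, Z.jump i j = 0 := fun j => by rw [Subsingleton.elim j i, Z.jump_self]
  simp [h3] at h2

variable [T2Space M] [SecondCountableTopology M] [MeasurableSpace M] [BorelSpace M]

lemma measurable_flow_max :
    Measurable fun p : Fin k × (ℝ × M) => forwardFlow (Z.field p.1) (max p.2.1 0) p.2.2 :=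
  measurable_from_prod_countable_right fun j =>
    measurable_forwardFlow_max (Z.field_mem_smoothFields j) (Z.forwardComplete j)

/-- Truncating the holding times at `0` gives a measurable map and alters nothing when they are
nonnegative, which is almost surely the case. -/
lemma exists_measurable_switchPosition (ξ : M) (m : ℕ) :
    ∃ F : (ℕ → Fin k × ℝ) → M, Measurable F ∧
      ∀ path, (∀ l, 0 ≤ (path l).2) → F path = Z.switchPosition ξ path m := by
  induction m with
  | zero => exact ⟨fun _ => ξ, measurable_const, fun _ _ => rfl⟩
  | succ m ih =>
    obtain ⟨F, hF, hFeq⟩ := ih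
    refine ⟨fun path => forwardFlow (Z.field (path m).1) (max (path m).2 0) (F path), ?_, ?_⟩
    · have h1 : Measurable fun path : ℕ → Fin k × ℝ => ((path m).1, ((path m).2, F path)) := by
        fun_prop
      exact Z.measurable_flow_max.comp h1
    · intro path h
      simp only [switchPosition, hFeq path h, max_eq_left (h m)]

lemma aemeasurable_state (ξ : M) (i : Fin k) {t : ℝ} (ht : 0 ≤ t) :
    AEMeasurable (fun path => (Z.position ξ path t, regime path t)) (Z.pathLaw i) := by
  choose F hF hFeq using Z.exists_measurable_switchPosition ξ
  set G : ℕ × (ℕ → Fin k × ℝ) → M := fun p =>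
    forwardFlow (Z.field (p.2 p.1).1) (max (t - switchTime p.2 p.1) 0) (F p.1 p.2) with hG
  have hGm : Measurable G := by
    refine measurable_from_prod_countable_right fun m => ?_
    have h1 : Measurable fun path : ℕ → Fin k × ℝ =>
        ((path m).1, (t - switchTime path m, F m path)) := by
      have := measurable_switchTime (k := k) m
      have := hF m
      fun_prop
    exact Z.measurable_flow_max.comp h1
  refine ⟨fun path => (G (switchCount path t, path), regime path t),
    (hGm.comp ((measurable_switchCount t).prodMk measurable_id)).prodMk (measurable_regime t), ?_⟩
  filter_upwards [Z.ae_holding_nonneg i] with path hpath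
  simp only [hG, position, hFeq _ path hpath, regime,
    max_eq_left (sub_nonneg.2 (switchTime_switchCount_le path ht))]

end SwitchingSystem

/-! ### Switched trajectories and null sets -/

section SwitchedTrajectories

open Set Filter Topology

variable {n : ℕ} {M : Type*} [TopologicalSpace M] [ChartedSpace (EuclideanSpace ℝ (Fin n)) M]
  [IsManifold (𝓡 n) ∞ M] [T2Space M]

/-- The pairs `(x, τ)` from which the flow on `[τ, t]` leads into a given null set form a null
set. -/
lemma volume_forwardFlow_sub_mem_eq_zero [SecondCountableTopology M] [MeasurableSpace M]
    [BorelSpace M] {v : ∀ x : M, TangentSpace (𝓡 n) x} (hv : v ∈ smoothFields n M)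
    (hc : ForwardComplete v) {N : Set M} (hNm : MeasurableSet N) (hN : ChartNull n N) (ξ : M)
    (t : ℝ) :
    volume {p : EuclideanSpace ℝ (Fin n) × ℝ | p.1 ∈ (extChartAt (𝓡 n) ξ).target ∧ p.2 ≤ t ∧
      forwardFlow v (t - p.2) ((extChartAt (𝓡 n) ξ).symm p.1) ∈ N} = 0 := by
  classical
  have htm : MeasurableSet (extChartAt (𝓡 n) ξ).target :=
    (isOpen_extChartAt_target ξ).measurableSet
  set h : EuclideanSpace ℝ (Fin n) → M :=
    (extChartAt (𝓡 n) ξ).target.piecewise (extChartAt (𝓡 n) ξ).symm (fun _ => ξ) with hh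
  have hhm : Measurable h :=
    (continuousOn_extChartAt_symm ξ).measurable_piecewise continuousOn_const htm
  have hheq : ∀ x ∈ (extChartAt (𝓡 n) ξ).target, h x = (extChartAt (𝓡 n) ξ).symm x :=
    fun x hx => piecewise_eq_of_mem _ _ _ hx
  set S : Set (EuclideanSpace ℝ (Fin n) × ℝ) :=
    ((extChartAt (𝓡 n) ξ).target ×ˢ Iic t) ∩
      {p | forwardFlow v (max (t - p.2) 0) (h p.1) ∈ N} with hS
  have hSm : MeasurableSet S := by
    refine (htm.prod measurableSet_Iic).inter ?_
    have h1 : Measurable fun p : EuclideanSpace ℝ (Fin n) × ℝ => (t - p.2, h p.1) := by fun_prop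
    exact ((measurable_forwardFlow_max hv hc).comp h1) hNm
  -- For fixed `τ` the section lies in the chart image of the preimage of `N` under a single flow
  -- map, hence is null; Fubini concludes.
  have hS0 : volume S = 0 := by
    rw [Measure.volume_eq_prod, Measure.prod_apply_symm hSm, lintegral_eq_zero_iff
      (measurable_measure_prodMk_right hSm)]
    refine Eventually.of_forall fun τ => ?_
    refine measure_mono_null ?_
      ((hN.preimage_forwardFlow hv hc (le_max_right (t - τ) 0)) ξ)
    rintro x ⟨⟨hx, -⟩, hxN⟩
    refine ⟨hx, ?_⟩
    change forwardFlow v (max (t - τ) 0) (h x) ∈ N at hxN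
    rwa [hheq x hx] at hxN
  refine measure_mono_null ?_ hS0
  rintro ⟨x, τ⟩ ⟨hx, hτ, hxN⟩
  refine ⟨⟨hx, hτ⟩, ?_⟩
  change forwardFlow v (max (t - τ) 0) (h x) ∈ N
  rwa [hheq x hx, max_eq_left (sub_nonneg.2 hτ)]

/-- While `C` times the elapsed time is below `r`, the trajectory remains in the chart ball, so each
stay can be followed by the local flow. -/
lemma SwitchingSystem.switchPosition_eq_endpoint {k : ℕ} (Z : SwitchingSystem n k M) {ξ : M}
    {r C ε : ℝ} {f : Fin k → EuclideanSpace ℝ (Fin n) → EuclideanSpace ℝ (Fin n)}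
    {Φ : Fin k → ℝ → EuclideanSpace ℝ (Fin n) → EuclideanSpace ℝ (Fin n)}
    (hball : Metric.ball (extChartAt (𝓡 n) ξ ξ) r ⊆ (extChartAt (𝓡 n) ξ).target)
    (hC : 0 < C) (hfC : ∀ j x, ‖f j x‖ ≤ C) (hΦ : ∀ j, IsLocalFlow (f j) ε (Φ j))
    (hf : ∀ j, ∀ y ∈ Metric.ball (extChartAt (𝓡 n) ξ ξ) r, f j y = chartField ξ (Z.field j) y)
    {path : ℕ → Fin k × ℝ} {w : ℕ → Fin k} {m : ℕ} (hw : ∀ l < m, (path l).1 = w l)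
    (h0 : ∀ l < m, 0 ≤ (path l).2) (hε : switchTime path m < ε) (hr : C * switchTime path m < r) :
    Z.switchPosition ξ path m = (extChartAt (𝓡 n) ξ).symm
      (endpoint Φ (extChartAt (𝓡 n) ξ ξ) w m (fun l => (path l).2)).1 := by
  induction m with
  | zero => exact ((extChartAt (𝓡 n) ξ).left_inv (mem_extChartAt_source ξ)).symm
  | succ m ih =>
    have hsum : ∑ l : Fin m, (path l).2 = switchTime path m :=
      Fin.sum_univ_eq_sum_range (fun l => (path l).2) m
    have hnn : 0 ≤ (path m).2 := h0 m (by omega)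
    have hnn' : 0 ≤ switchTime path m := by
      rw [← hsum]
      exact Finset.sum_nonneg fun l _ => h0 l (by omega)
    rw [switchTime_succ] at hε hr
    have hle : C * switchTime path m ≤ C * (switchTime path m + (path m).2) := by
      gcongr
      linarith
    have h1 := ih (fun l hl => hw l (by omega)) (fun l hl => h0 l (by omega)) (by linarith)
      (by linarith)
    have h2 := dist_endpoint_le hΦ hfC (extChartAt (𝓡 n) ξ ξ) w (fun l : Fin m => (path l).2)
      (fun l => h0 l (by omega)) (by rw [hsum]; linarith)
    rw [hsum] at h2
    rw [switchPosition, h1, hw m (by omega)]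
    exact forwardFlow_extChartAt_symm (Z.field_mem_smoothFields _) (Z.forwardComplete _) hball hC
      (hfC _) (hΦ _) (hf _) hnn (by linarith) (by linarith)

end SwitchedTrajectories

/-! ### The absolutely continuous component -/

section MainTheorem

open Set Filter Topology SwitchingSystem

theorem theorem2 {n k : ℕ} {M : Type*} [TopologicalSpace M]
    [ChartedSpace (EuclideanSpace ℝ (Fin n)) M] [IsManifold (𝓡 n) ∞ M] [T2Space M]
    [SecondCountableTopology M] [MeasurableSpace M] [BorelSpace M]
    (g : SmoothMetric n M) (Z : SwitchingSystem n k M) (ξ : M) (hA : ConditionA Z.field ξ)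
    (i : Fin k) (t : ℝ) (ht : 0 < t) :
    HasNonzeroACComponent (Z.transition t ξ i)
      ((lebesgueMeasure g).prod (Measure.count : Measure (Fin k))) := by
  have := Z.nontrivial_regimes i
  have hstate := Z.aemeasurable_state ξ i ht.le
  have : IsFiniteMeasure (Z.transition t ξ i) := by
    unfold transition
    infer_instance
  -- Assume that the null set `B` carries the law; a set of paths of positive probability that end
  -- outside `B` gives the contradiction.
  refine hasNonzeroACComponent_of_forall_null _ _ fun B hBm hB0 hB1 => ?_
  rw [transition, Measure.map_apply_of_aemeasurable hstate hBm.compl] at hB1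
  obtain ⟨r, hr, hball, f, K, C, ε, Φ, hε, hC, hfK, hfC, hΦ, hf⟩ :=
    exists_localFlow_chartField ξ Z.field_mem_smoothFields
  set x₀ := extChartAt (𝓡 n) ξ ξ with hx₀
  -- Below `δ` the local flows exist, the trajectory stays in the chart ball, and time remains for a
  -- last stay before `t`.
  set δ := min (min ε (r / C)) t with hδ
  have hδpos : 0 < δ := by positivity
  have hδle : ∀ τ < δ, τ < ε ∧ C * τ < r ∧ τ < t := by
    intro τ hτ
    simp only [hδ, lt_min_iff, lt_div_iff₀ hC] at hτ
    exact ⟨hτ.1.1, by linarith [hτ.1.2], hτ.2⟩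
  obtain ⟨a, T, hT, y, m, w, s₀, A, hw0, hw, hwm, hs₀, hend, hder, hrange⟩ :=
    exists_attains_top Z.field_mem_smoothFields hA hr hball hε hC hfK hfC hΦ hf i hδpos
  -- The regime of the last stay must differ from the preceding regime `a`.
  obtain ⟨j, hj⟩ := exists_ne a
  have hBj : ChartNull n {x | (x, j) ∈ B} := by
    refine ChartNull.of_lebesgueMeasure_eq_zero g ?_
    rw [Measure.measure_prod_null hBm, Filter.EventuallyEq, ae_iff] at hB0
    refine measure_mono_null ?_ hB0
    intro x hx h
    have h1 : Prod.mk x ⁻¹' B = ∅ := Measure.count_eq_zero_iff.1 h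
    exact (Set.ext_iff.1 h1 j).1 hx
  -- The configurations from which following `u_j` until time `t` leads into `B`.
  set N := {p : EuclideanSpace ℝ (Fin n) × ℝ | p.1 ∈ (extChartAt (𝓡 n) ξ).target ∧ p.2 ≤ t ∧
      forwardFlow (Z.field j) (t - p.2) ((extChartAt (𝓡 n) ξ).symm p.1) ∈ {x | (x, j) ∈ B}}
  have hN : volume N = 0 := volume_forwardFlow_sub_mem_eq_zero (Z.field_mem_smoothFields j)
    (Z.forwardComplete j) (measurable_prodMk_right hBm) hBj ξ t
  have : (volume : Measure (EuclideanSpace ℝ (Fin n) × ℝ)).IsAddHaarMeasure :=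
    inferInstanceAs ((volume : Measure (EuclideanSpace ℝ (Fin n))).prod
      (volume : Measure ℝ)).IsAddHaarMeasure
  obtain ⟨U, hU, hUN⟩ := hder.exists_nhds_null_preimage volume volume
    (LinearMap.range_eq_top.1 hrange)
  have hcont : Continuous fun s : Fin (m + 1) → ℝ => ∑ l, s l := by fun_prop
  have hsum₀ : ∑ l, s₀ l < δ := by
    rw [← endpoint_snd Φ x₀ w s₀, hend]
    exact hT
  obtain ⟨V, hVU, hVo, hsV⟩ := mem_nhds_iff.1
    (inter_mem hU (hcont.continuousAt.preimage_mem_nhds (Iio_mem_nhds hsum₀)))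
  set W := V ∩ {s : Fin (m + 1) → ℝ | ∀ l, 0 < s l} with hW
  have hWo : IsOpen W := by
    refine hVo.inter ?_
    simp only [ofPred_forall]
    exact isOpen_iInter_of_finite fun l => isOpen_lt continuous_const (continuous_apply l)
  -- Some of the times `s₀` may be `0`, as inserted stays have length `0`; adding a small constant
  -- makes all of them positive.
  have hWne : W.Nonempty := by
    have h1 : Continuous fun c : ℝ => (fun l => s₀ l + c : Fin (m + 1) → ℝ) := by fun_prop
    have h2 : ∀ᶠ c in 𝓝[>] (0 : ℝ), (fun l => s₀ l + c : Fin (m + 1) → ℝ) ∈ V :=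
      mem_nhdsWithin_of_mem_nhds (h1.continuousAt.preimage_mem_nhds
        (hVo.mem_nhds (by simpa using hsV)))
    obtain ⟨c, hcV, hc⟩ := (h2.and self_mem_nhdsWithin).exists
    exact ⟨_, hcV, fun l => add_pos_of_nonneg_of_pos (hs₀ l) hc⟩
  -- The times leading to `N` are removed together with a measurable null hull; what is left of the
  -- nonempty open set `W` has positive volume.
  set D := W \ toMeasurable volume (U ∩ endpoint Φ x₀ w (m + 1) ⁻¹' N) with hD
  have hDm : MeasurableSet D := hWo.measurableSet.diff (measurableSet_toMeasurable _ _)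
  have hDvol : volume D ≠ 0 := by
    rw [hD, measure_sdiff_null (by rw [measure_toMeasurable]; exact hUN N hN)]
    exact (hWo.measure_pos volume hWne).ne'
  -- A last holding time above `t` ensures that time `t` falls into the last stay.
  set D' := {s : Fin (m + 2) → ℝ | (fun l : Fin (m + 1) => s l.castSucc) ∈ D ∧
    t < s (Fin.last (m + 1))} with hD'
  have hD'm : MeasurableSet D' := by
    have h1 : Measurable fun s : Fin (m + 2) → ℝ => fun l : Fin (m + 1) => s l.castSucc := by
      fun_prop
    exact (h1 hDm).inter (measurableSet_lt measurable_const (measurable_pi_apply _))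
  have hD'vol : volume D' ≠ 0 := by
    rw [Ne, volume_eq_zero_iff_snoc hD'm]
    intro h
    refine hDvol (measure_mono_null (fun s hs => ?_) h)
    have h1 : {a : ℝ | (Fin.snoc s a : Fin (m + 2) → ℝ) ∈ D'} = Ioi t := by
      ext a
      simp [hD', hs]
    change volume {a : ℝ | (Fin.snoc s a : Fin (m + 2) → ℝ) ∈ D'} ≠ 0
    rw [h1]
    simp
  have hD'pos : ∀ s ∈ D', ∀ l, 0 < s l := by
    intro s hs l
    refine Fin.lastCases (ht.trans hs.2) (fun l => ?_) l
    exact hs.1.1.2 l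
  set w' : ℕ → Fin k := fun l => if l ≤ m then w l else j with hw'
  refine Z.pathLaw_ne_zero i w' (by simp [hw', hw0]) (m + 1) (fun l hl => ?_) hD'm hD'pos hD'vol
    (measure_mono_null ?_ hB1)
  · rcases (Nat.lt_succ_iff.1 hl).lt_or_eq with h | rfl
    · simpa [hw', h.le, Nat.succ_le_of_lt h] using hw l h
    · simpa [hw', hwm] using hj.symm
  rintro path ⟨hpw, hpD⟩
  have hpD1 : (fun l : Fin (m + 1) => (path l).2) ∈ D := hpD.1
  have hpD2 : t < (path (m + 1)).2 := by simpa using hpD.2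
  have hsum : ∀ q, ∑ l : Fin q, (path l).2 = switchTime path q :=
    fun q => Fin.sum_univ_eq_sum_range (fun l => (path l).2) q
  have hpos : ∀ l ≤ m, 0 < (path l).2 := fun l hl => hpD1.1.2 ⟨l, by omega⟩
  have hUs : (fun l : Fin (m + 1) => (path l).2) ∈ U := (hVU hpD1.1.1).1
  have htime : switchTime path (m + 1) < δ := by
    rw [← hsum]
    exact (hVU hpD1.1.1).2
  obtain ⟨htε, htr, htt⟩ := hδle _ htime
  have hcount : switchCount path t = m + 1 := by
    refine switchCount_eq_of_lt path ?_ fun l hl => ?_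
    · rw [switchTime_succ]
      have : 0 ≤ switchTime path (m + 1) := by
        rw [← hsum]
        exact Finset.sum_nonneg fun l _ => (hpos l (by omega)).le
      linarith
    · refine le_trans ?_ htt.le
      exact Finset.sum_le_sum_of_subset_of_nonneg (Finset.range_subset_range.2 (by omega))
        fun q hq _ => (hpos q (by have := Finset.mem_range.1 hq; omega)).le
  have hregime : regime path t = j := by
    rw [regime, hcount, hpw _ le_rfl]
    simp [hw']
  have hposition := Z.switchPosition_eq_endpoint hball hC hfC hΦ hf (path := path) (w := w)
    (m := m + 1) (fun l hl => by rw [hpw l (by omega)]; simp [hw', Nat.lt_succ_iff.1 hl])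
    (fun l hl => (hpos l (by omega)).le) htε htr
  have hdist := dist_endpoint_le hΦ hfC x₀ w (fun l : Fin (m + 1) => (path l).2)
    (fun l => (hpos l (by omega)).le) (by rw [hsum]; exact htε)
  rw [hsum] at hdist
  change (Z.position ξ path t, regime path t) ∉ B
  rw [position, hregime, hcount, hposition]
  intro hmem
  -- Ending in `B` would put the reached configuration into `N`, but such times were removed from
  -- `D`.
  refine hpD1.2 (subset_toMeasurable _ _ ⟨hUs, hball (hdist.trans_lt htr), ?_, ?_⟩)
  · rw [endpoint_snd, hsum]
    exact htt.le
  · rw [endpoint_snd, hsum]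
    exact hmem

end MainTheorem
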